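/- **Setting.** Let $(\mathcal X,\mathcal A)$ be a measurable space, let $\mathcal Y=\mathcal Y_1\times\dots\times\mathcal Y_l$ be a product of finite label sets, and let $G=(V,F,E)$ be a factor graph with variable nodes $V=\{1,\dots,l\}$, a finite set $F$ of factor nodes, and edges $E$ between variable nodes and factor nodes. For $f\in F$ let $\mathcal N(f)\subseteq V$ be the set of nodes connected to $f$, put $\mathcal Y_f=\prod_{k\in\mathcal N(f)}\mathcal Y_k$, and for $y\in\mathcal Y$ let $y_f\in\mathcal Y_f$ be its restriction to $\mathcal N(f)$. Assume $|\mathcal Y_f|=d$ for all $f\in F$. For each $f\in F$ let $\Psi_f:\mathcal X\times\mathcal Y_f\to\mathbb R^D$ be a measurable feature map, and put $\Psi(x,y)=\sum_{f\in F}\Psi_f(x,y_f)$. Let $1<p\le 2$, $q=p/(p-1)$, $\Lambda\ge 0$, and $$\mathcal H_p=\{(x,y)\mapsto\langle w,\Psi(x,y)\rangle : w\in\mathbb R^D,\ \|w\|_p\le\Lambda\},\qquad \Psi^*=\sup_{f\in F,\;x\in\mathcal X,\;y\in\mathcal Y_f}\|\Psi_f(x,y)\|_q ,$$ where $\Psi^*$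 is assumed to be finite (and is read as $0$ if $F=\emptyset$). Let $L:\mathcal Y\times\mathcal Y\to[0,\infty)$ be a loss function with $M=\max_{y,y'}L(y,y')$. For $\rho>0$ and $h:\mathcal X\times\mathcal Y\to\mathbb R$ define the margin loss $$L_\rho(x,y,h)=\min\Big(M,\max\Big(0,\ \max_{y'\ne y}\big\{L(y',y)-\tfrac1\rho[h(x,y)-h(x,y')]\big\}\Big)\Big)$$ (a maximum over the empty set is read as $0$). Let $\mathcal D$ be a probability distribution on $\mathcal X\times\mathcal Y$, let $S=((x_i,y_i))_{i=1}^m$ be drawn i.i.d. from $\mathcal D$ with $m\ge 2$, and put $$R(h)=\mathbb E_{(x,y)\sim\mathcal D}[L_\rho(x,y,h)],\qquad R_S(h)=\frac1m\sum_{i=1}^m L_\rho(x_i,y_i,h).$$ **Theorem (Generalization bounds).** For every $\rho>0$ and $\delta\in(0,1)$, with probability at least $1-\delta$ over the draw of $S$, the following bound holds simultaneously for all $h\in\mathcal H_p$: $$R(h)\le R_S(h)+\frac8m+\frac{288\sqrt{q-1}\,\Psi^*\Lambda|F|}{\rho\sqrt m}\,\tilde L+M\sqrt{\frac{\log(1/\delta)}{2m}},$$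 where $$\tilde L=\sqrt{\log\big(2md|F|\,[\,8\Psi^*\Lambda m|F|/\rho+3\,]+1\big)}\;\log m .$$ In particular, the bound depends on $d$ only logarithmically. -/

import Mathlib

open MeasureTheory

noncomputable section

namespace StructuredPrediction

/-- A factor graph with variable nodes `Fin l` and factor nodes `F`; `edge k f` says that the
variable node `k` and the factor node `f` are joined by an undirected edge. -/
structure FactorGraph (l : ℕ) (F : Type*) where
  edge : Fin l → F → Prop

/-- The set `N(f)` of the variable nodes connected to the factor `f`. -/
def FactorGraph.nbhd {l : ℕ} {F : Type*} (G : FactorGraph l F) (f : F) : Set (Fin l) :=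
  {k | G.edge k f}

/-- The set `𝒴_f = ∏_{k ∈ N(f)} 𝒴_k` of the partial labels of the factor `f`. -/
abbrev FactorGraph.Label {l : ℕ} {F : Type*} (G : FactorGraph l F) (Y : Fin l → Type*) (f : F) :
    Type _ :=
  ∀ k : G.nbhd f, Y k

/-- The partial label `y_f` of a full label `y`. -/
def FactorGraph.restrict {l : ℕ} {F : Type*} (G : FactorGraph l F) {Y : Fin l → Type*} (f : F)
    (y : ∀ k, Y k) : G.Label Y f :=
  fun k => y k

/-- The `ℓ_p` norm on `ℝ^D`. -/
def ellNorm {D : ℕ} (p : ℝ) (v : Fin D → ℝ) : ℝ :=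
  ‖(WithLp.toLp (ENNReal.ofReal p) v : PiLp (ENNReal.ofReal p) (fun _ : Fin D => ℝ))‖

/-- The maximal value `M = max_{y, y'} L(y, y')` of the loss. -/
def maxLoss {Y : Type*} (L : Y → Y → ℝ) : ℝ :=
  ⨆ z : Y × Y, L z.1 z.2

/-- The clipping function `Φ^*(r) = min(M, max(0, r))`. -/
def clip (M r : ℝ) : ℝ :=
  min M (max 0 r)

/-- The margin loss
`L_ρ(x, y, h) = Φ^*(max_{y' ≠ y} { L(y', y) - (1 / ρ) [h(x, y) - h(x, y')] })`.
If `y` is the only label, the maximum over the empty set counts as `0`, which after clipping is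
the same as counting it as `-∞`. -/
def marginLoss {X Y : Type*} (L : Y → Y → ℝ) (ρ : ℝ) (x : X) (y : Y) (h : X → Y → ℝ) : ℝ :=
  clip (maxLoss L) (⨆ y' : {y' : Y // y' ≠ y}, (L y' y - (1 / ρ) * (h x y - h x y')))

/-- The population risk `R(h) = 𝔼_𝒟[L_ρ(x, y, h)]`. -/
def risk {X Y : Type*} [MeasurableSpace X] [MeasurableSpace Y] (𝒟 : Measure (X × Y))
    (L : Y → Y → ℝ) (ρ : ℝ) (h : X → Y → ℝ) : ℝ :=
  ∫ z, marginLoss L ρ z.1 z.2 h ∂𝒟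

/-- The empirical risk `R_S(h) = (1 / m) ∑_i L_ρ(x_i, y_i, h)`. -/
def empRisk {X Y : Type*} {m : ℕ} (S : Fin m → X × Y) (L : Y → Y → ℝ) (ρ : ℝ)
    (h : X → Y → ℝ) : ℝ :=
  (1 / (m : ℝ)) * ∑ i, marginLoss L ρ (S i).1 (S i).2 h

section Features

variable {l D : ℕ} {F : Type*} {X : Type*} {Y : Fin l → Type*} {G : FactorGraph l F}

/-- The composite feature map `Ψ(x, y) = ∑_{f ∈ F} Ψ_f(x, y_f)`. -/
def feature [Fintype F] (Ψ : ∀ f : F, X → G.Label Y f → (Fin D → ℝ)) (x : X) (y : ∀ k, Y k) :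
    Fin D → ℝ :=
  ∑ f, Ψ f x (G.restrict f y)

/-- The linear scoring function `h^w(x, y) = ⟨w, Ψ(x, y)⟩`. -/
def linearScore [Fintype F] (Ψ : ∀ f : F, X → G.Label Y f → (Fin D → ℝ)) (w : Fin D → ℝ)
    (x : X) (y : ∀ k, Y k) : ℝ :=
  ∑ i, w i * feature Ψ x y i

/-- The hypothesis class `ℋ_p` of the functions `h^w` with `‖w‖_p ≤ Λ`. -/
def hypothesisClass [Fintype F] (Ψ : ∀ f : F, X → G.Label Y f → (Fin D → ℝ)) (p Λ : ℝ) :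
    Set (X → (∀ k, Y k) → ℝ) :=
  {h | ∃ w : Fin D → ℝ, ellNorm p w ≤ Λ ∧ h = linearScore Ψ w}

/-- The set of all the norms `‖Ψ_f(x, y)‖_q`, over `f ∈ F`, `x ∈ 𝒳` and `y ∈ 𝒴_f`. -/
def featureNorms (Ψ : ∀ f : F, X → G.Label Y f → (Fin D → ℝ)) (q : ℝ) : Set ℝ :=
  {r | ∃ (f : F) (x : X) (y : G.Label Y f), r = ellNorm q (Ψ f x y)}

/-- `Ψ^* = sup_{f, x, y} ‖Ψ_f(x, y)‖_q`. -/
def featureSup (Ψ : ∀ f : F, X → G.Label Y f → (Fin D → ℝ)) (q : ℝ) : ℝ :=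
  sSup (featureNorms Ψ q)

end Features

/-- `L̃ = √(log(2 m d |F| [8 Ψ^* Λ m |F| / ρ + 3] + 1)) · log m`, with `N = |F|` and `B = Ψ^*`. -/
def logFactor (m d N : ℕ) (B Λ ρ : ℝ) : ℝ :=
  √(Real.log (2 * m * d * N * (8 * B * Λ * m * N / ρ + 3) + 1)) * Real.log m

end StructuredPrediction

end

/-! The supremum of `R(h) - R_S(h)` concentrates by McDiarmid, since replacing one example moves it
by at most `M / m`. Symmetrization bounds its mean by twice a Rademacher average of the loss class,
divided by `m`. The work lies in bounding that average with no dependence on `D` and only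
logarithmic dependence on `d`.

The margin loss is `2 / ρ`-Lipschitz in the scores, and a score is a sum of `|F|` numbers `⟨w,
Ψ_f(x, y_f)⟩`. To approximate all scores on the sample it therefore suffices to approximate `w` on
the `n = m d |F|` vectors `Ψ_f(x_i, y_f)`; the far more numerous full labels never enter.

The space `ℓ_q` with `q ≥ 2` is 2-uniformly smooth with constant of order `q`
(`sq_norm_add_sq_norm_sub_le`). Greedy descent on the potential `‖θ‖² / 2 - w θ`
(`exists_finset_potential`, `exists_finset_approx`) then approximates the ball of radius `Λ` on `n`
vectors of norm at most `B` to accuracy `2 √(4q) Λ B / √k` by at most `(2n + 1) ^ k` functionals.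

With `k = 4 ^ j` the log-cardinality grows as the inverse square of the scale, so all levels of
`chaining` cost the same, and about `log m` levels are used. This produces the factor `√(log n) ·
log m`.

To keep suprema attained and measurable, the deviation bound is proved for finite families of
weights and extended to the whole ball by density and continuity
(`measure_forall_mem_of_forall_finite`). -/

namespace StructuredPrediction

/-! ### Sparse approximation of functionals on a 2-uniformly smooth space. -/

section UniformSmoothness

/-- The functional is `‖x‖` times a norming functional of `x`. Testing that norming functional on `x
- y` bounds `‖x - y‖²` below by the square of `‖x‖ - g y`, which turns the two-sided smoothness
inequality into a one-sided quadratic expansion. -/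
theorem exists_subgradient_sq_norm {E : Type*} [NormedAddCommGroup E] [NormedSpace ℝ E] {K : ℝ}
    (hK : ∀ x y : E, ‖x + y‖ ^ 2 + ‖x - y‖ ^ 2 ≤ 2 * ‖x‖ ^ 2 + 2 * K * ‖y‖ ^ 2) (x : E) :
    ∃ g : StrongDual ℝ E, ∀ y, ‖x + y‖ ^ 2 ≤ ‖x‖ ^ 2 + 2 * g y + 2 * K * ‖y‖ ^ 2 := by
  obtain ⟨g, hg, hgx⟩ := exists_dual_vector'' ℝ x
  refine ⟨‖x‖ • g, fun y => ?_⟩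
  have h1 : |g (x - y)| ≤ ‖x - y‖ := by
    simpa using g.le_of_opNorm_le hg (x - y)
  have h2 : g (x - y) = ‖x‖ - g y := by simp [hgx]
  have h3 : (‖x‖ - g y) ^ 2 ≤ ‖x - y‖ ^ 2 := by
    rw [← h2, ← sq_abs]; gcongr
  have h4 := hK x y
  have h5 : (‖x‖ • g) y = ‖x‖ * g y := by simp
  rw [h5]
  nlinarith [sq_nonneg (g y)]

/-- Descent on the potential `‖θ‖² / 2 - w θ`: whenever `g θ` misses `w` by more than `ε` at some `v
i`, a step `±η • v i` lowers the potential by at least `η ε - K η² B²`. A step has `2n + 1` options,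
including rest, so `k` steps reach at most `(2n + 1) ^ k` points, whatever `w` is. -/
theorem exists_finset_potential {E ι : Type*} [NormedAddCommGroup E] [NormedSpace ℝ E] [Fintype ι]
    {K B : ℝ} (hK0 : 0 ≤ K) {g : E → StrongDual ℝ E}
    (hg : ∀ x y, ‖x + y‖ ^ 2 ≤ ‖x‖ ^ 2 + 2 * g x y + 2 * K * ‖y‖ ^ 2)
    {v : ι → E} (hv : ∀ i, ‖v i‖ ≤ B) {ε η : ℝ} (hη : 0 ≤ η) (k : ℕ) :
    ∃ Θ : Finset E, Θ.card ≤ (2 * Fintype.card ι + 1) ^ k ∧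
      ∀ w : StrongDual ℝ E, ∃ θ ∈ Θ, (∀ i, |(w - g θ) (v i)| ≤ ε) ∨
        ‖θ‖ ^ 2 / 2 - w θ ≤ -(k * (η * ε - K * η ^ 2 * B ^ 2)) := by
  classical
  induction k with
  | zero => exact ⟨{0}, by simp, fun w => ⟨0, by simp⟩⟩
  | succ k ih =>
    obtain ⟨Θ, hcard, hΘ⟩ := ih
    let A : Finset E := insert 0
      (Finset.univ.image (fun i => η • v i) ∪ Finset.univ.image (fun i => -(η • v i)))
    have hA : A.card ≤ 2 * Fintype.card ι + 1 := by
      refine (Finset.card_insert_le _ _).trans ?_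
      have h1 := Finset.card_union_le (Finset.univ.image (fun i => η • v i))
        (Finset.univ.image (fun i => -(η • v i)))
      have h2 := Finset.card_image_le (s := (Finset.univ : Finset ι)) (f := fun i => η • v i)
      have h3 := Finset.card_image_le (s := (Finset.univ : Finset ι)) (f := fun i => -(η • v i))
      rw [Finset.card_univ] at h2 h3
      omega
    refine ⟨Finset.image₂ (· + ·) Θ A, ?_, fun w => ?_⟩
    · refine (Finset.card_image₂_le _ _ _).trans ?_
      rw [pow_succ]
      gcongr
    · obtain ⟨θ, hθ, h⟩ := hΘ w
      by_cases hgood : ∀ i, |(w - g θ) (v i)| ≤ ε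
      · exact ⟨θ + 0, Finset.mem_image₂_of_mem hθ (by simp [A]), Or.inl (by simpa using hgood)⟩
      have h := h.resolve_left hgood
      push Not at hgood
      obtain ⟨i, hi⟩ := hgood
      have key : ∀ s : ℝ, s ^ 2 = 1 → ε ≤ s * (w - g θ) (v i) →
          ‖θ + s • (η • v i)‖ ^ 2 / 2 - w (θ + s • (η • v i)) ≤
            -((k + 1 : ℕ) * (η * ε - K * η ^ 2 * B ^ 2)) := by
        intro s hs hε
        have h1 := hg θ (s • (η • v i))
        have h2 : ‖s • (η • v i)‖ ^ 2 ≤ η ^ 2 * B ^ 2 := by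
          rw [norm_smul, norm_smul, mul_pow, mul_pow, Real.norm_eq_abs, Real.norm_eq_abs, sq_abs,
            sq_abs, hs, one_mul]
          gcongr
          exact hv i
        have h3 : K * ‖s • (η • v i)‖ ^ 2 ≤ K * (η ^ 2 * B ^ 2) := by gcongr
        have h4 : η * ε ≤ η * (s * (w - g θ) (v i)) := by gcongr
        simp only [map_smul, smul_eq_mul, map_add, sub_apply] at h1 h4 ⊢
        push_cast
        linarith
      rcases lt_abs.1 hi with hi | hi
      · refine ⟨θ + η • v i, Finset.mem_image₂_of_mem hθ (by simp [A]), Or.inr ?_⟩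
        simpa using key 1 (by norm_num) (by linarith)
      · refine ⟨θ + -(η • v i), Finset.mem_image₂_of_mem hθ (by simp [A]), Or.inr ?_⟩
        simpa [neg_smul] using key (-1) (by norm_num) (by linarith)

/-- In the dual of a 2-uniformly smooth space, a ball can be approximated on finitely many bounded
points by few functionals. -/
theorem exists_finset_approx {E ι : Type*} [NormedAddCommGroup E] [NormedSpace ℝ E] [Fintype ι]
    {K B Λ : ℝ} (hK0 : 0 < K)
    (hK : ∀ x y : E, ‖x + y‖ ^ 2 + ‖x - y‖ ^ 2 ≤ 2 * ‖x‖ ^ 2 + 2 * K * ‖y‖ ^ 2)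
    {v : ι → E} (hB : 0 ≤ B) (hv : ∀ i, ‖v i‖ ≤ B) (hΛ : 0 ≤ Λ) {k : ℕ} (hk : 0 < k) :
    ∃ T : Finset (StrongDual ℝ E), T.card ≤ (2 * Fintype.card ι + 1) ^ k ∧
      ∀ w : StrongDual ℝ E, ‖w‖ ≤ Λ → ∃ u ∈ T, ∀ i, |(w - u) (v i)| ≤ 2 * √K * Λ * B / √k := by
  classical
  rcases (mul_nonneg hΛ hB).eq_or_lt with h0 | h0
  · refine ⟨{0}, by simpa using Nat.one_le_pow _ _ (by omega), fun w hw => ⟨0, by simp, fun i => ?_⟩⟩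
    calc |(w - 0) (v i)| ≤ ‖w‖ * ‖v i‖ := by simpa using w.le_opNorm (v i)
      _ ≤ Λ * B := by gcongr; exact hv i
      _ ≤ _ := by rw [← h0]; positivity
  have hB' : 0 < B := pos_of_mul_pos_right h0 hΛ
  have hΛ' : 0 < Λ := pos_of_mul_pos_left h0 hB
  choose g hg using exists_subgradient_sq_norm hK
  have hk' : (0 : ℝ) < k := by exact_mod_cast hk
  -- With this step size, `k` unsuccessful steps push the potential down to `-Λ²`, whereas `‖w‖ ≤ Λ`
  -- keeps it at least `-Λ² / 2`.
  obtain ⟨Θ, hcard, hΘ⟩ := exists_finset_potential hK0.le hg hv (ε := 2 * √K * Λ * B / √k)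
    (η := Λ / (√K * B * √k)) (by positivity) k
  refine ⟨Θ.image g, Finset.card_image_le.trans hcard, fun w hw => ?_⟩
  obtain ⟨θ, hθ, h | h⟩ := hΘ w
  · exact ⟨g θ, Finset.mem_image_of_mem _ hθ, h⟩
  · exfalso
    have e : (k : ℝ) * (Λ / (√K * B * √k) * (2 * √K * Λ * B / √k) -
        K * (Λ / (√K * B * √k)) ^ 2 * B ^ 2) = Λ ^ 2 := by
      have h1 : √(k : ℝ) ^ 2 = k := Real.sq_sqrt hk'.le
      have h2 : √K ^ 2 = K := Real.sq_sqrt hK0.le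
      have h3 : 0 < √(k : ℝ) := by positivity
      have h4 : 0 < √K := by positivity
      field_simp
      rw [h1, h2]; field_simp; ring
    rw [e] at h
    have h1 : w θ ≤ Λ * ‖θ‖ := (le_abs_self _).trans (w.le_of_opNorm_le hw θ)
    nlinarith [sq_nonneg (‖θ‖ - Λ), sq_pos_of_pos hΛ']

end UniformSmoothness

/-! ### Uniform smoothness of `ℓ_q` for `q ≥ 2`. -/

section LpSmoothness

/-- For small `t` the left side is at most `2 cosh (q t) ≤ 2 exp (q² t² / 2)`, and `exp u ≤ 1 / (1 -
u) ≤ 1 + 4 u` for `u = q t² ≤ 3 / 4`. For larger `t` already `(1 + t)² ≤ 1 + 4 q t²`. -/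
theorem two_point_ineq_one {q t : ℝ} (hq : 2 ≤ q) (ht : 0 ≤ t) :
    (1 + t) ^ q + |1 - t| ^ q ≤ 2 * (1 + 4 * q * t ^ 2) ^ (q / 2) := by
  have hq0 : 0 < q := by linarith
  rcases le_or_gt (q * t ^ 2) (3 / 4) with h | h
  · have ht1 : t ≤ 1 := by nlinarith [sq_nonneg t]
    have h1 : (1 + t) ^ q ≤ Real.exp (q * t) := by
      rw [mul_comm, Real.exp_mul]
      exact Real.rpow_le_rpow (by linarith) (by linarith [Real.add_one_le_exp t]) hq0.le
    have h2 : |1 - t| ^ q ≤ Real.exp (-(q * t)) := by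
      rw [abs_of_nonneg (by linarith), show -(q * t) = -t * q by ring, Real.exp_mul]
      exact Real.rpow_le_rpow (by linarith) (by linarith [Real.add_one_le_exp (-t)]) hq0.le
    have h3 := Real.cosh_le_exp_half_sq (q * t)
    rw [Real.cosh_eq] at h3
    have h4 : Real.exp ((q * t) ^ 2 / 2) ≤ (1 + 4 * q * t ^ 2) ^ (q / 2) := by
      rw [show (q * t) ^ 2 / 2 = (q * t ^ 2) * (q / 2) by ring, Real.exp_mul]
      refine Real.rpow_le_rpow (Real.exp_pos _).le ?_ (by linarith)
      set u := q * t ^ 2 with hu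
      have hu0 : 0 ≤ u := by positivity
      have h5 := Real.add_one_le_exp (-u)
      have h6 : Real.exp u * Real.exp (-u) = 1 := by rw [← Real.exp_add]; simp
      have h7 := Real.exp_pos u
      have h8 : Real.exp u * (1 - u) ≤ 1 := by nlinarith
      have h9 : 1 ≤ (1 + 4 * u) * (1 - u) := by nlinarith
      have h10 : Real.exp u * (1 - u) ≤ (1 + 4 * u) * (1 - u) := h8.trans h9
      have := le_of_mul_le_mul_right h10 (by linarith)
      linarith
    linarith
  · have hm : (1 + t) ^ 2 ≤ 1 + 4 * q * t ^ 2 := by nlinarith [sq_nonneg (t - 1), sq_nonneg t]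
    have h1 : (1 + t) ^ q ≤ (1 + 4 * q * t ^ 2) ^ (q / 2) := by
      calc (1 + t) ^ q = ((1 + t) ^ 2) ^ (q / 2) := by
            rw [← Real.rpow_natCast_mul (by linarith)]; congr 1; push_cast; ring
        _ ≤ _ := Real.rpow_le_rpow (by positivity) hm (by linarith)
    have h2 : |1 - t| ^ q ≤ (1 + t) ^ q :=
      Real.rpow_le_rpow (abs_nonneg _) (abs_le.2 ⟨by linarith, by linarith⟩) hq0.le
    linarith

theorem two_point_ineq_of_nonneg {q a b : ℝ} (hq : 2 ≤ q) (ha : 0 ≤ a) (hb : 0 ≤ b) :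
    (a + b) ^ q + |a - b| ^ q ≤ 2 * (a ^ 2 + 4 * q * b ^ 2) ^ (q / 2) := by
  have hq0 : 0 < q := by linarith
  have hpow : ∀ c : ℝ, 0 ≤ c → (c ^ 2) ^ (q / 2) = c ^ q := fun c hc => by
    rw [← Real.rpow_natCast_mul hc]; congr 1; push_cast; ring
  rcases ha.eq_or_lt with rfl | ha
  · have h : b ^ q ≤ (4 * q * b ^ 2) ^ (q / 2) := by
      rw [← hpow b hb]
      exact Real.rpow_le_rpow (by positivity) (by nlinarith [sq_nonneg b]) (by linarith)
    simp only [zero_add, zero_sub, abs_neg, abs_of_nonneg hb, ne_eq, OfNat.ofNat_ne_zero,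
      not_false_eq_true, zero_pow]
    linarith
  · have h := two_point_ineq_one hq (div_nonneg hb ha.le)
    have e1 : a + b = a * (1 + b / a) := by field_simp
    have e2 : |a - b| = a * |1 - b / a| := by
      rw [← abs_of_pos ha, ← abs_mul, abs_of_pos ha]; congr 1; field_simp
    have e3 : a ^ 2 + 4 * q * b ^ 2 = a ^ 2 * (1 + 4 * q * (b / a) ^ 2) := by field_simp
    rw [e1, e2, e3, Real.mul_rpow ha.le (by positivity), Real.mul_rpow ha.le (by positivity),
      Real.mul_rpow (by positivity) (by positivity), hpow a ha.le]
    have := mul_le_mul_of_nonneg_left h (Real.rpow_nonneg ha.le q)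
    linarith

theorem two_point_ineq {q : ℝ} (hq : 2 ≤ q) (a b : ℝ) :
    |a + b| ^ q + |a - b| ^ q ≤ 2 * (a ^ 2 + 4 * q * b ^ 2) ^ (q / 2) := by
  have h := two_point_ineq_of_nonneg hq (abs_nonneg a) (abs_nonneg b)
  rw [sq_abs, sq_abs] at h
  refine le_trans (le_of_eq ?_) h
  rcases le_total 0 a with ha | ha <;> rcases le_total 0 b with hb | hb
  · rw [abs_of_nonneg ha, abs_of_nonneg hb, abs_of_nonneg (add_nonneg ha hb)]
  · rw [abs_of_nonneg ha, abs_of_nonpos hb, abs_of_nonneg (by linarith : 0 ≤ a - b), add_comm,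
      sub_neg_eq_add]; rfl
  · rw [abs_of_nonpos ha, abs_of_nonneg hb, abs_of_nonpos (by linarith : a - b ≤ 0), add_comm,
      ← abs_neg (-a - b)]; ring_nf
  · rw [abs_of_nonpos ha, abs_of_nonpos hb, abs_of_nonpos (by linarith : a + b ≤ 0),
      ← abs_neg (-a - -b)]; ring_nf

theorem ellNorm_eq_sum {D : ℕ} {p : ℝ} (hp : 0 < p) (v : Fin D → ℝ) :
    ellNorm p v = (∑ i, |v i| ^ p) ^ (1 / p) := by
  have := PiLp.norm_eq_sum (p := ENNReal.ofReal p) (β := fun _ : Fin D => ℝ)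
    (by rwa [ENNReal.toReal_ofReal hp.le]) (WithLp.toLp (ENNReal.ofReal p) v)
  rw [ENNReal.toReal_ofReal hp.le] at this
  exact this

/-- Convexity of `c ↦ c ^ (q / 2)` reduces the claim to `q`-th powers, where the two-point
inequality applies coordinatewise. Minkowski in `ℓ_{q/2}` then separates the squares of `x` from
those of `y`. -/
theorem sq_norm_add_sq_norm_sub_le {D : ℕ} {q : ℝ} (hq : 2 ≤ q) (x y : Fin D → ℝ) :
    ellNorm q (x + y) ^ 2 + ellNorm q (x - y) ^ 2 ≤
      2 * ellNorm q x ^ 2 + 2 * (4 * q) * ellNorm q y ^ 2 := by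
  have hq0 : 0 < q := by linarith
  set r := q / 2 with hr
  have hr1 : 1 ≤ r := by rw [hr]; linarith
  have hr0 : 0 < r := by linarith
  have hpow : ∀ c : ℝ, (c ^ 2) ^ r = |c| ^ q := fun c => by
    rw [← sq_abs, ← Real.rpow_natCast_mul (abs_nonneg c)]; congr 1; push_cast; ring
  have hsq : ∀ z : Fin D → ℝ, ellNorm q z ^ 2 = (∑ i, (z i ^ 2) ^ r) ^ (1 / r) := fun z => by
    simp_rw [hpow]
    rw [ellNorm_eq_sum hq0, ← Real.rpow_mul_natCast (Finset.sum_nonneg fun i _ => by positivity)]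
    congr 1
    rw [hr]; push_cast; field_simp
  have hsqr : ∀ z : Fin D → ℝ, (ellNorm q z ^ 2) ^ r = ∑ i, |z i| ^ q := fun z => by
    rw [hsq, ← Real.rpow_mul (Finset.sum_nonneg fun i _ => by positivity), one_div,
      inv_mul_cancel₀ hr0.ne', Real.rpow_one]
    simp_rw [hpow]
  have h1 := (convexOn_rpow hr1).2 (Set.mem_Ici.2 (sq_nonneg (ellNorm q (x + y))))
    (Set.mem_Ici.2 (sq_nonneg (ellNorm q (x - y)))) (by norm_num : (0 : ℝ) ≤ 1 / 2)
    (by norm_num : (0 : ℝ) ≤ 1 / 2) (by norm_num)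
  simp only [smul_eq_mul] at h1
  have h2 : 1 / 2 * (ellNorm q (x + y) ^ 2) ^ r + 1 / 2 * (ellNorm q (x - y) ^ 2) ^ r ≤
      ∑ i, (x i ^ 2 + 4 * q * y i ^ 2) ^ r := by
    rw [hsqr, hsqr, Finset.mul_sum, Finset.mul_sum, ← Finset.sum_add_distrib]
    refine Finset.sum_le_sum fun i _ => ?_
    have := two_point_ineq hq (x i) (y i)
    simp only [Pi.add_apply, Pi.sub_apply]
    linarith
  have h3 := Real.Lp_add_le_of_nonneg Finset.univ hr1 (f := fun i => x i ^ 2)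
    (g := fun i => 4 * q * y i ^ 2) (fun i _ => by positivity) (fun i _ => by positivity)
  have h4 : (∑ i, (4 * q * y i ^ 2) ^ r) ^ (1 / r) = 4 * q * ellNorm q y ^ 2 := by
    rw [hsq]
    have h : ∀ i, (4 * q * y i ^ 2) ^ r = (4 * q) ^ r * (y i ^ 2) ^ r := fun i =>
      Real.mul_rpow (by positivity) (sq_nonneg (y i))
    rw [Finset.sum_congr rfl fun i _ => h i, ← Finset.mul_sum, Real.mul_rpow (by positivity) (Finset.sum_nonneg fun i _ => by positivity),
      ← Real.rpow_mul (by positivity), one_div, mul_inv_cancel₀ hr0.ne', Real.rpow_one]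
  rw [← hsq, h4] at h3
  have h5 := Real.rpow_le_rpow (by positivity) (h1.trans h2) (by positivity : 0 ≤ 1 / r)
  rw [← Real.rpow_mul (by positivity), mul_one_div_cancel hr0.ne', Real.rpow_one] at h5
  linarith

end LpSmoothness

/-! ### Rademacher averages: Massart's lemma and chaining. -/

section Rademacher

open Finset BigOperators

/-- The sign `±1` encoded by a Boolean. -/
def boolSign (b : Bool) : ℝ := if b then 1 else -1

theorem boolSign_not (b : Bool) : boolSign (!b) = -boolSign b := by
  cases b <;> simp [boolSign]

/-- The sum factors over coordinates, and `cosh a ≤ exp (a² / 2)`. -/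
theorem sum_exp_boolSign {m : ℕ} (a : Fin m → ℝ) :
    ∑ σ : Fin m → Bool, Real.exp (∑ i, boolSign (σ i) * a i) ≤
      2 ^ m * Real.exp ((∑ i, a i ^ 2) / 2) := by
  have h1 : ∑ σ : Fin m → Bool, Real.exp (∑ i, boolSign (σ i) * a i) =
      ∏ i, ∑ b : Bool, Real.exp (boolSign b * a i) := by
    rw [Finset.prod_univ_sum, Fintype.piFinset_univ]
    simp_rw [Real.exp_sum]
  have h2 : ∀ i, ∑ b : Bool, Real.exp (boolSign b * a i) ≤ 2 * Real.exp (a i ^ 2 / 2) := by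
    intro i
    have := Real.cosh_le_exp_half_sq (a i)
    rw [Real.cosh_eq] at this
    simp only [Fintype.sum_bool, boolSign, if_true, one_mul, Bool.false_eq_true, if_false,
      neg_one_mul]
    linarith
  rw [h1, Finset.sum_div, Real.exp_sum]
  calc _ ≤ ∏ i, (2 * Real.exp (a i ^ 2 / 2)) :=
        Finset.prod_le_prod (fun i _ => Finset.sum_nonneg fun b _ => (Real.exp_pos _).le)
          fun i _ => h2 i
    _ = _ := by rw [Finset.prod_mul_distrib]; simp

/-- Jensen's inequality, by averaging the tangent line of `exp` at the mean. -/
theorem exp_expect_le {ι : Type*} [Fintype ι] [Nonempty ι] (f : ι → ℝ) :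
    Real.exp (𝔼 i, f i) ≤ 𝔼 i, Real.exp (f i) := by
  set c := 𝔼 i, f i with hc
  have h : ∀ i, Real.exp c * (1 + (f i - c)) ≤ Real.exp (f i) := fun i => by
    have h1 := Real.add_one_le_exp (f i - c)
    have h2 : Real.exp (f i) = Real.exp c * Real.exp (f i - c) := by
      rw [← Real.exp_add]; ring_nf
    rw [h2]
    have := Real.exp_pos c
    gcongr
    linarith
  calc Real.exp c = 𝔼 i, Real.exp c * (1 + (f i - c)) := by
        rw [← Finset.mul_expect, Finset.expect_add_distrib, Finset.expect_sub_distrib, ← hc]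
        simp
    _ ≤ _ := Finset.expect_le_expect fun i _ => h i

/-- The optimal choice is `t = √(2 N) / R`; the degenerate cases `R = 0` and `N = 0` need other
values of `t`. -/
theorem le_mul_sqrt_of_forall_le {y N R : ℝ} (hN : 0 ≤ N) (hR : 0 ≤ R)
    (h : ∀ t : ℝ, 0 < t → t * y ≤ N + t ^ 2 * R ^ 2 / 2) : y ≤ R * √(2 * N) := by
  by_contra! hy
  rcases hR.eq_or_lt with rfl | hR
  · rw [zero_mul] at hy
    have := h ((N + 1) / y) (by positivity)
    rw [div_mul_cancel₀ _ hy.ne'] at this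
    simp at this
    linarith
  rcases hN.eq_or_lt with rfl | hN
  · simp only [mul_zero, Real.sqrt_zero] at hy
    have := h (y / R ^ 2) (by positivity)
    have e : y / R ^ 2 * y = y ^ 2 / R ^ 2 := by ring
    have e2 : (y / R ^ 2) ^ 2 * R ^ 2 / 2 = y ^ 2 / R ^ 2 / 2 := by field_simp
    rw [e, e2] at this
    have : 0 < y ^ 2 / R ^ 2 := by positivity
    linarith
  · have := h (√(2 * N) / R) (by positivity)
    have hs : √(2 * N) ^ 2 = 2 * N := Real.sq_sqrt (by positivity)
    have e : (√(2 * N) / R) ^ 2 * R ^ 2 / 2 = N := by field_simp; linarith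
    rw [e] at this
    have h2 : √(2 * N) / R * (R * √(2 * N)) < √(2 * N) / R * y := by gcongr
    have h3 : √(2 * N) / R * (R * √(2 * N)) = √(2 * N) ^ 2 := by field_simp
    linarith

/-- **Massart's lemma**, for a maximizing element of the finite set chosen for each sign vector. -/
theorem massart {m : ℕ} (A : Finset (Fin m → ℝ)) {N R : ℝ} (hR : 0 ≤ R)
    (hN : (A.card : ℝ) ≤ Real.exp N) (hAR : ∀ a ∈ A, ∑ i, a i ^ 2 ≤ R ^ 2)
    (hN0 : 0 ≤ N) (a : (Fin m → Bool) → Fin m → ℝ) (ha : ∀ σ, a σ ∈ A) :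
    𝔼 σ, ∑ i, boolSign (σ i) * a σ i ≤ R * √(2 * N) := by
  refine le_mul_sqrt_of_forall_le hN0 hR fun t ht => ?_
  rw [← Real.exp_le_exp, Finset.mul_expect]
  refine (exp_expect_le _).trans ?_
  rw [Finset.expect_eq_sum_div_card, div_le_iff₀ (by positivity)]
  calc ∑ σ : Fin m → Bool, Real.exp (t * ∑ i, boolSign (σ i) * a σ i)
      ≤ ∑ σ : Fin m → Bool, ∑ b ∈ A, Real.exp (t * ∑ i, boolSign (σ i) * b i) :=
        Finset.sum_le_sum fun σ _ => Finset.single_le_sum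
          (f := fun b : Fin m → ℝ => Real.exp (t * ∑ i, boolSign (σ i) * b i))
          (fun b _ => (Real.exp_pos _).le) (ha σ)
    _ = ∑ b ∈ A, ∑ σ : Fin m → Bool, Real.exp (∑ i, boolSign (σ i) * (t * b i)) := by
        rw [Finset.sum_comm]
        refine Finset.sum_congr rfl fun b _ => Finset.sum_congr rfl fun σ _ => ?_
        rw [Finset.mul_sum]
        congr 1
        exact Finset.sum_congr rfl fun i _ => by ring
    _ ≤ ∑ b ∈ A, 2 ^ m * Real.exp (t ^ 2 * R ^ 2 / 2) := by
        refine Finset.sum_le_sum fun b hb => (sum_exp_boolSign _).trans ?_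
        simp_rw [mul_pow, ← Finset.mul_sum]
        gcongr
        exact hAR b hb
    _ = A.card * (2 ^ m * Real.exp (t ^ 2 * R ^ 2 / 2)) := by simp
    _ ≤ Real.exp N * (2 ^ m * Real.exp (t ^ 2 * R ^ 2 / 2)) := by gcongr
    _ = _ := by rw [Real.exp_add]; simp; ring

/-- **Dudley's chaining bound** for a class whose covering numbers at scale `e / 2 ^ j` are at most
`exp (4 ^ j * N)`. -/
theorem chaining {W : Type*} {m : ℕ} (ℓ : W → Fin m → ℝ) (s : Set W) (T : ℕ → Finset W)
    {e N : ℝ} (he : 0 ≤ e) (hN : 0 ≤ N) (hT : ∀ j, ((T j).card : ℝ) ≤ Real.exp (4 ^ j * N))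
    (hT0 : (T 0).card ≤ 1)
    (hcover : ∀ j, ∀ w ∈ s, ∃ u ∈ T j, ∀ i, |ℓ w i - ℓ u i| ≤ e / 2 ^ j)
    (J : ℕ) (w : (Fin m → Bool) → W) (hw : ∀ σ, w σ ∈ s) :
    𝔼 σ, ∑ i, boolSign (σ i) * ℓ (w σ) i ≤
      m * (e / 2 ^ J) + J * (3 / 2 * √m * e * √(10 * N)) := by
  classical
  choose! π hπT hπ using hcover
  have hstep : ∀ J : ℕ, 𝔼 σ, ∑ i, boolSign (σ i) * ℓ (π J (w σ)) i ≤
      J * (3 / 2 * √m * e * √(10 * N)) := by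
    intro J
    induction J with
    | zero =>
      -- With at most one vector, Massart applies with `N = 0` and gives the bound `0`, so any
      -- radius `R` will do.
      have hle : ∃ R : ℝ, 0 ≤ R ∧ ∀ a ∈ (T 0).image ℓ, ∑ i, a i ^ 2 ≤ R ^ 2 := by
        refine ⟨√(∑ a ∈ (T 0).image ℓ, ∑ i, a i ^ 2), Real.sqrt_nonneg _, fun a ha => ?_⟩
        rw [Real.sq_sqrt (by positivity)]
        exact Finset.single_le_sum (f := fun a : Fin m → ℝ => ∑ i, a i ^ 2)
          (fun a _ => by positivity) ha
      obtain ⟨R, hR, hR2⟩ := hle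
      have := massart ((T 0).image ℓ) hR (N := 0)
        (by rw [Real.exp_zero]; exact_mod_cast Finset.card_image_le.trans hT0) hR2 le_rfl
        (fun σ => ℓ (π 0 (w σ))) (fun σ => Finset.mem_image_of_mem _ (hπT 0 _ (hw σ)))
      simpa using this
    | succ j ih =>
      -- Only differences of nearby approximants matter: both lie close to the same `w σ`, so they
      -- differ by at most `e / 2 ^ (j + 1) + e / 2 ^ j`.
      let A : Finset (Fin m → ℝ) := (Finset.image₂ (fun u u' => ℓ u - ℓ u') (T (j + 1)) (T j)).filter
        (fun a => ∀ i, |a i| ≤ 3 / 2 * (e / 2 ^ j))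
      have hA : (A.card : ℝ) ≤ Real.exp (5 * 4 ^ j * N) := by
        calc (A.card : ℝ) ≤ ((T (j + 1)).card * (T j).card : ℕ) := by
              exact_mod_cast (Finset.card_filter_le _ _).trans (Finset.card_image₂_le _ _ _)
          _ ≤ Real.exp (4 ^ (j + 1) * N) * Real.exp (4 ^ j * N) := by
              push_cast; gcongr
              · exact hT _
              · exact hT _
          _ = _ := by rw [← Real.exp_add]; congr 1; ring
      have hAR : ∀ a ∈ A, ∑ i, a i ^ 2 ≤ (√m * (3 / 2 * (e / 2 ^ j))) ^ 2 := by
        intro a ha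
        have h := (Finset.mem_filter.1 ha).2
        calc ∑ i, a i ^ 2 ≤ ∑ i : Fin m, (3 / 2 * (e / 2 ^ j)) ^ 2 := by
              refine Finset.sum_le_sum fun i _ => ?_
              rw [← sq_abs]
              have := h i
              gcongr
          _ = _ := by rw [mul_pow √(m : ℝ), Real.sq_sqrt (by positivity)]; simp
      have hmem : ∀ σ, ℓ (π (j + 1) (w σ)) - ℓ (π j (w σ)) ∈ A := by
        intro σ
        refine Finset.mem_filter.2 ⟨Finset.mem_image₂_of_mem (hπT _ _ (hw σ)) (hπT _ _ (hw σ)),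
          fun i => ?_⟩
        have h1 := hπ (j + 1) _ (hw σ) i
        have h2 := hπ j _ (hw σ) i
        have h3 : e / 2 ^ (j + 1) = e / 2 ^ j / 2 := by rw [pow_succ]; field_simp
        rw [h3] at h1
        rw [abs_le] at h1 h2 ⊢
        simp only [Pi.sub_apply]
        constructor <;> linarith [h1.1, h1.2, h2.1, h2.2]
      have hmas := massart A (by positivity) hA hAR (by positivity) _ hmem
      -- The radius shrinks like `2 ^ (-j)` while the root of the log-cardinality grows like `2 ^
      -- j`, so each level contributes the same amount.
      have hval : √m * (3 / 2 * (e / 2 ^ j)) * √(2 * (5 * 4 ^ j * N)) =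
          3 / 2 * √m * e * √(10 * N) := by
        have h4 : √(2 * (5 * 4 ^ j * N)) = 2 ^ j * √(10 * N) := by
          rw [show 2 * (5 * 4 ^ j * N) = (2 ^ j) ^ 2 * (10 * N) by
            rw [← pow_mul, mul_comm j 2, pow_mul]; ring, Real.sqrt_mul (by positivity),
            Real.sqrt_sq (by positivity)]
        rw [h4]; field_simp
      rw [hval] at hmas
      have hsplit : 𝔼 σ, ∑ i, boolSign (σ i) * ℓ (π (j + 1) (w σ)) i =
          𝔼 σ, ∑ i, boolSign (σ i) * (ℓ (π (j + 1) (w σ)) - ℓ (π j (w σ))) i +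
            𝔼 σ, ∑ i, boolSign (σ i) * ℓ (π j (w σ)) i := by
        rw [← Finset.expect_add_distrib]
        refine Finset.expect_congr rfl fun σ _ => ?_
        rw [← Finset.sum_add_distrib]
        refine Finset.sum_congr rfl fun i _ => ?_
        simp only [Pi.sub_apply]; ring
      rw [hsplit]
      push_cast
      linarith
  have hlast : 𝔼 σ, ∑ i, boolSign (σ i) * ℓ (w σ) i ≤
      m * (e / 2 ^ J) + 𝔼 σ, ∑ i, boolSign (σ i) * ℓ (π J (w σ)) i := by
    have : (m * (e / 2 ^ J) : ℝ) = 𝔼 _σ : Fin m → Bool, (m * (e / 2 ^ J) : ℝ) := by simp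
    rw [this, ← Finset.expect_add_distrib]
    refine Finset.expect_le_expect fun σ _ => ?_
    have : (m * (e / 2 ^ J) : ℝ) = ∑ _i : Fin m, e / 2 ^ J := by simp
    rw [this, ← Finset.sum_add_distrib]
    refine Finset.sum_le_sum fun i _ => ?_
    have h := abs_le.1 (hπ J _ (hw σ) i)
    unfold boolSign
    split_ifs <;> linarith [h.1, h.2]
  exact hlast.trans (by linarith [hstep J])

end Rademacher

/-! ### McDiarmid's inequality through moment generating functions. -/

section McDiarmid

open ProbabilityTheory

variable {Z : Type*} [MeasurableSpace Z] (μ : Measure Z) [IsProbabilityMeasure μ]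

theorem integrable_of_abs_le {Ω : Type*} [MeasurableSpace Ω] {P : Measure Ω} [IsFiniteMeasure P]
    {f : Ω → ℝ} (hf : Measurable f) {C : ℝ} (hC : ∀ x, |f x| ≤ C) : Integrable f P :=
  Integrable.of_bound hf.aestronglyMeasurable C (Filter.Eventually.of_forall hC)

theorem integrable_exp_mul_of_abs_le {Ω : Type*} [MeasurableSpace Ω] {P : Measure Ω}
    [IsFiniteMeasure P] {f : Ω → ℝ} (hf : Measurable f) {C : ℝ} (hC : ∀ x, |f x| ≤ C) (t : ℝ) :
    Integrable (fun x => Real.exp (t * f x)) P := by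
  refine integrable_of_abs_le (by fun_prop) (C := Real.exp (|t| * C)) fun x => ?_
  rw [abs_of_pos (Real.exp_pos _), Real.exp_le_exp]
  refine (le_abs_self _).trans ?_
  rw [abs_mul]
  gcongr
  exact hC x

/-- Hoeffding's lemma: the values of `g` lie in an interval of length `c` starting at its infimum.
-/
theorem integral_exp_le_of_oscillation {g : Z → ℝ} (hg : Measurable g) {C : ℝ}
    (hC : ∀ z, |g z| ≤ C) {c : ℝ} (hosc : ∀ z z', g z - g z' ≤ c) (t : ℝ) :
    ∫ z, Real.exp (t * g z) ∂μ ≤ Real.exp (t * ∫ z, g z ∂μ + c ^ 2 * t ^ 2 / 8) := by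
  have : Nonempty Z := μ.nonempty_of_neZero
  have hbdd : BddBelow (Set.range g) := ⟨-C, by rintro _ ⟨z, rfl⟩; exact (abs_le.1 (hC z)).1⟩
  have hmem : ∀ z, g z ∈ Set.Icc (⨅ z, g z) ((⨅ z, g z) + c) := fun z => by
    refine ⟨ciInf_le hbdd z, ?_⟩
    have : g z - c ≤ ⨅ z, g z := le_ciInf fun z' => by linarith [hosc z z']
    linarith
  have h := (hasSubgaussianMGF_of_mem_Icc (μ := μ) hg.aemeasurable
    (Filter.Eventually.of_forall hmem)).mgf_le t
  have e : ∀ z, Real.exp (t * (g z - ∫ z, g z ∂μ)) =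
      Real.exp (t * g z) * Real.exp (-(t * ∫ z, g z ∂μ)) := fun z => by
    rw [← Real.exp_add]; congr 1; ring
  simp only [mgf, e] at h
  rw [integral_mul_const, Real.exp_neg, ← div_eq_mul_inv, div_le_iff₀ (Real.exp_pos _),
    ← Real.exp_add] at h
  refine h.trans (le_of_eq ?_)
  congr 1
  simp only [add_sub_cancel_left, NNReal.coe_pow, NNReal.coe_div, coe_nnnorm, Real.norm_eq_abs,
    NNReal.coe_ofNat, div_pow, sq_abs]
  ring

theorem integral_pi_succ {m : ℕ} (F : (Fin (m + 1) → Z) → ℝ) :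
    ∫ S, F S ∂(Measure.pi fun _ : Fin (m + 1) => μ) =
      ∫ p : Z × (Fin m → Z), F (Fin.cons p.1 p.2) ∂(μ.prod (Measure.pi fun _ : Fin m => μ)) := by
  rw [← ((measurePreserving_piFinSuccAbove (fun _ : Fin (m + 1) => μ) 0).symm).integral_comp']
  refine integral_congr_ae (Filter.Eventually.of_forall fun p => congrArg F ?_)
  exact Fin.insertNth_zero' p.1 p.2

/-- The moment generating function estimate behind **McDiarmid's inequality**. -/
theorem integral_exp_le_of_bounded_differences {c : ℝ} {m : ℕ}
    {f : (Fin m → Z) → ℝ} (hf : Measurable f) {C : ℝ} (hC : ∀ S, |f S| ≤ C)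
    (hdiff : ∀ S i z, f (Function.update S i z) - f S ≤ c) (t : ℝ) :
    ∫ S, Real.exp (t * f S) ∂(Measure.pi fun _ : Fin m => μ) ≤
      Real.exp (t * ∫ S, f S ∂(Measure.pi fun _ : Fin m => μ) + m * (c ^ 2 * t ^ 2 / 8)) := by
  induction m with
  | zero =>
    have h : ∀ S, f S = f default := fun S => congrArg f (Subsingleton.elim _ _)
    simp_rw [h]
    simp
  | succ m ih =>
    set P := Measure.pi fun _ : Fin m => μ
    have hcons : Measurable fun p : Z × (Fin m → Z) => (Fin.cons p.1 p.2 : Fin (m + 1) → Z) := by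
      refine measurable_pi_iff.2 fun i => ?_
      refine Fin.cases ?_ (fun j => ?_) i
      · simpa using measurable_fst
      · simp only [Fin.cons_succ]; fun_prop
    have hF : Measurable fun p : Z × (Fin m → Z) => f (Fin.cons p.1 p.2) := hf.comp hcons
    have hFz : ∀ z, Measurable fun S : Fin m → Z => f (Fin.cons z S) := fun z =>
      hF.comp (by fun_prop : Measurable fun S : Fin m → Z => (z, S))
    rw [integral_pi_succ, integral_pi_succ, integral_prod _ (integrable_exp_mul_of_abs_le hF
      (fun p => hC _) t), integral_prod _ (integrable_of_abs_le hF fun p => hC _)]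
    simp only
    -- Averaging out all but the first coordinate gives a function of oscillation at most `c`.
    -- Induction handles the other coordinates, Hoeffding's lemma this one.
    set g : Z → ℝ := fun z => ∫ S, f (Fin.cons z S) ∂P with hg
    have hgm : Measurable g := (hF.stronglyMeasurable.integral_prod_right').measurable
    have hgC : ∀ z, |g z| ≤ C := fun z => by
      have := norm_integral_le_of_norm_le_const (μ := P) (f := fun S => f (Fin.cons z S)) (C := C)
        (Filter.Eventually.of_forall fun S => hC _)
      simpa using this
    have hosc : ∀ z z', g z - g z' ≤ c := fun z z' => by
      rw [hg, ← integral_sub (integrable_of_abs_le (hFz z) fun S => hC _)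
        (integrable_of_abs_le (hFz z') fun S => hC _)]
      have h1 : ∀ S : Fin m → Z, f (Fin.cons z S) - f (Fin.cons z' S) ≤ c := fun S => by
        have := hdiff (Fin.cons z' S) 0 z
        rwa [Fin.update_cons_zero] at this
      have := integral_mono (μ := P) ((integrable_of_abs_le (hFz z) fun S => hC _).sub
        (integrable_of_abs_le (hFz z') fun S => hC _)) (integrable_const c) h1
      simpa using this
    calc ∫ z, ∫ S, Real.exp (t * f (Fin.cons z S)) ∂P ∂μ
        ≤ ∫ z, Real.exp (t * g z) * Real.exp (m * (c ^ 2 * t ^ 2 / 8)) ∂μ := by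
          refine integral_mono (integrable_exp_mul_of_abs_le hF (fun p => hC _) t).integral_prod_left
            ((integrable_exp_mul_of_abs_le hgm hgC t).mul_const _) fun z => ?_
          rw [← Real.exp_add]
          refine ih (hFz z) (fun S => hC _) fun S i z' => ?_
          have := hdiff (Fin.cons z S) i.succ z'
          rwa [← Fin.cons_update] at this
      _ = (∫ z, Real.exp (t * g z) ∂μ) * Real.exp (m * (c ^ 2 * t ^ 2 / 8)) :=
          integral_mul_const _ _
      _ ≤ Real.exp (t * ∫ z, g z ∂μ + c ^ 2 * t ^ 2 / 8) * Real.exp (m * (c ^ 2 * t ^ 2 / 8)) := by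
          gcongr
          exact integral_exp_le_of_oscillation μ hgm hgC hosc t
      _ = _ := by
          rw [← Real.exp_add]; congr 1; push_cast; ring

/-- **McDiarmid's inequality**. -/
theorem mcdiarmid {c : ℝ} {m : ℕ}
    {f : (Fin m → Z) → ℝ} (hf : Measurable f) {C : ℝ} (hC : ∀ S, |f S| ≤ C)
    (hdiff : ∀ S i z, f (Function.update S i z) - f S ≤ c) {ε : ℝ} (hε : 0 ≤ ε) :
    (Measure.pi fun _ : Fin m => μ).real
        {S | ε ≤ f S - ∫ S, f S ∂(Measure.pi fun _ : Fin m => μ)} ≤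
      Real.exp (-(2 * ε ^ 2) / (m * c ^ 2)) := by
  set P := Measure.pi fun _ : Fin m => μ
  have hsub : HasSubgaussianMGF (fun S => f S - ∫ S, f S ∂P)
      (Real.toNNReal (m * c ^ 2 / 4)) P := by
    have e : ∀ t S, Real.exp (t * (f S - ∫ S, f S ∂P)) =
        Real.exp (t * f S) * Real.exp (-(t * ∫ S, f S ∂P)) := fun t S => by
      rw [← Real.exp_add]; congr 1; ring
    refine ⟨fun t => ?_, fun t => ?_⟩
    · simp only [e]
      exact (integrable_exp_mul_of_abs_le hf hC t).mul_const _
    · simp only [mgf, e]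
      rw [integral_mul_const, Real.exp_neg, ← div_eq_mul_inv, div_le_iff₀ (Real.exp_pos _),
        ← Real.exp_add, Real.coe_toNNReal _ (by positivity)]
      refine (integral_exp_le_of_bounded_differences μ hf hC hdiff t).trans (le_of_eq ?_)
      congr 1; ring
  have := hsub.measure_ge_le hε
  rw [Real.coe_toNNReal _ (by positivity)] at this
  refine this.trans (le_of_eq ?_)
  congr 1
  -- If `m c² = 0`, both quotients are `0` by convention and the bound is the trivial `1`.
  rcases eq_or_ne ((m : ℝ) * c ^ 2) 0 with h | h
  · rw [h]; simp
  · field_simp; ring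

end McDiarmid

/-! ### Symmetrization and the uniform deviation bound for finite classes. -/

section Symmetrization

open Finset BigOperators

variable {Z ι : Type*} {m : ℕ} {ℓ : ι → Z → ℝ} {M : ℝ}

theorem mean_mem_Icc (hm : 0 < m) (h0 : ∀ h z, 0 ≤ ℓ h z)
    (hM : ∀ h z, ℓ h z ≤ M) (h : ι) (S : Fin m → Z) :
    (1 / (m : ℝ)) * ∑ i, ℓ h (S i) ∈ Set.Icc 0 M := by
  have hm' : (0 : ℝ) < m := by exact_mod_cast hm
  refine ⟨mul_nonneg (by positivity) (Finset.sum_nonneg fun i _ => h0 h _), ?_⟩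
  have : ∑ i, ℓ h (S i) ≤ ∑ _i : Fin m, M := Finset.sum_le_sum fun i _ => hM h _
  rw [Finset.sum_const, Finset.card_univ, Fintype.card_fin, nsmul_eq_mul] at this
  calc (1 / (m : ℝ)) * ∑ i, ℓ h (S i) ≤ (1 / (m : ℝ)) * (m * M) := by gcongr
    _ = M := by field_simp

/-- The largest gap between the sample sums of the second and the first components. -/
noncomputable def pairDeviation (ℓ : ι → Z → ℝ) (S : Fin m → Z × Z) : ℝ :=
  ⨆ h, ∑ i, (ℓ h (S i).2 - ℓ h (S i).1)

theorem abs_pairDeviation_le [Finite ι] [Nonempty ι] (h0 : ∀ h z, 0 ≤ ℓ h z) (hM : ∀ h z, ℓ h z ≤ M)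
    (S : Fin m → Z × Z) : |pairDeviation ℓ S| ≤ m * M := by
  obtain ⟨h, hh⟩ := exists_eq_ciSup_of_finite (f := fun h => ∑ i, (ℓ h (S i).2 - ℓ h (S i).1))
  rw [pairDeviation, ← hh]
  refine (Finset.abs_sum_le_sum_abs _ _).trans ?_
  calc _ ≤ ∑ _i : Fin m, M := Finset.sum_le_sum fun i _ => abs_le.2
        ⟨by linarith [h0 h (S i).2, hM h (S i).1], by linarith [hM h (S i).2, h0 h (S i).1]⟩
    _ = _ := by simp

/-- Exchange the two components at the coordinates where the sign is negative. -/
def swapAt (σ : Fin m → Bool) (S : Fin m → Z × Z) : Fin m → Z × Z :=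
  fun i => if σ i then S i else (S i).swap

/-- For each sign vector a maximizer is selected. The second components then form a Rademacher sum,
and so do the first ones after the negated signs are absorbed by reindexing; each sum is at most
`R`. -/
theorem expect_pairDeviation_swapAt_le [Finite ι] [Nonempty ι] {R : ℝ}
    (hR : ∀ (S : Fin m → Z) (w : (Fin m → Bool) → ι),
      𝔼 σ, ∑ i, boolSign (σ i) * ℓ (w σ) (S i) ≤ R) (S : Fin m → Z × Z) :
    𝔼 σ, pairDeviation ℓ (swapAt σ S) ≤ 2 * R := by
  have hex : ∀ σ, ∃ h, ∑ i, (ℓ h (swapAt σ S i).2 - ℓ h (swapAt σ S i).1) =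
      pairDeviation ℓ (swapAt σ S) := fun σ => exists_eq_ciSup_of_finite
    (f := fun h => ∑ i, (ℓ h (swapAt σ S i).2 - ℓ h (swapAt σ S i).1))
  choose w hw using hex
  have h1 := hR (fun i => (S i).2) w
  have h2 := hR (fun i => (S i).1) (fun σ => w fun i => !(σ i))
  let e : (Fin m → Bool) ≃ (Fin m → Bool) :=
    ⟨fun σ i => !(σ i), fun σ i => !(σ i), fun σ => by ext; simp, fun σ => by ext; simp⟩
  have h3 : 𝔼 σ : Fin m → Bool, ∑ i, boolSign (σ i) * ℓ (w fun i => !(σ i)) (S i).1 =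
      𝔼 σ : Fin m → Bool, ∑ i, -(boolSign (σ i) * ℓ (w σ) (S i).1) := by
    refine Fintype.expect_equiv e _ _ fun σ => ?_
    refine Finset.sum_congr rfl fun i _ => ?_
    simp only [e, Equiv.coe_fn_mk, boolSign_not]
    ring
  rw [h3] at h2
  calc 𝔼 σ, pairDeviation ℓ (swapAt σ S)
      = 𝔼 σ, ∑ i, boolSign (σ i) * ℓ (w σ) (S i).2 +
          𝔼 σ, ∑ i, -(boolSign (σ i) * ℓ (w σ) (S i).1) := by
        rw [← Finset.expect_add_distrib]
        refine Finset.expect_congr rfl fun σ _ => ?_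
        rw [← hw, ← Finset.sum_add_distrib]
        refine Finset.sum_congr rfl fun i _ => ?_
        by_cases h : σ i <;> simp [swapAt, boolSign, h] <;> ring
    _ ≤ 2 * R := by linarith

variable [MeasurableSpace Z] (μ : Measure Z)

/-- The largest gap between expectation and sample mean. -/
noncomputable def supDeviation (ℓ : ι → Z → ℝ) (S : Fin m → Z) : ℝ :=
  ⨆ h, (∫ z, ℓ h z ∂μ - (1 / (m : ℝ)) * ∑ i, ℓ h (S i))

theorem le_supDeviation [Finite ι] (S : Fin m → Z) (h : ι) :
    ∫ z, ℓ h z ∂μ - (1 / (m : ℝ)) * ∑ i, ℓ h (S i) ≤ supDeviation μ ℓ S :=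
  le_ciSup (f := fun h => ∫ z, ℓ h z ∂μ - (1 / (m : ℝ)) * ∑ i, ℓ h (S i))
    (Set.finite_range _).bddAbove h

theorem exists_eq_supDeviation [Finite ι] [Nonempty ι] (ℓ : ι → Z → ℝ) (S : Fin m → Z) :
    ∃ h, ∫ z, ℓ h z ∂μ - (1 / (m : ℝ)) * ∑ i, ℓ h (S i) = supDeviation μ ℓ S :=
  exists_eq_ciSup_of_finite (f := fun h => ∫ z, ℓ h z ∂μ - (1 / (m : ℝ)) * ∑ i, ℓ h (S i))

theorem measurable_supDeviation [Finite ι] (hℓ : ∀ h, Measurable (ℓ h)) :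
    Measurable (supDeviation μ ℓ : (Fin m → Z) → ℝ) := by
  refine Measurable.iSup fun h => ?_
  have := hℓ h
  fun_prop

theorem integral_mem_Icc [IsProbabilityMeasure μ] (hℓ : ∀ h, Measurable (ℓ h)) (h0 : ∀ h z, 0 ≤ ℓ h z)
    (hM : ∀ h z, ℓ h z ≤ M) (h : ι) : ∫ z, ℓ h z ∂μ ∈ Set.Icc 0 M := by
  refine ⟨integral_nonneg (h0 h), ?_⟩
  have := integral_mono (μ := μ) (integrable_of_abs_le (hℓ h) (C := M) fun z => by
    rw [abs_of_nonneg (h0 h z)]; exact hM h z) (integrable_const M) (hM h)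
  simpa using this

theorem abs_supDeviation_le [IsProbabilityMeasure μ] [Finite ι] [Nonempty ι] (hm : 0 < m) (hℓ : ∀ h, Measurable (ℓ h)) (h0 : ∀ h z, 0 ≤ ℓ h z)
    (hM : ∀ h z, ℓ h z ≤ M) (S : Fin m → Z) : |supDeviation μ ℓ S| ≤ M := by
  obtain ⟨h, hh⟩ := exists_eq_supDeviation μ ℓ S
  have h1 := integral_mem_Icc μ hℓ h0 hM h
  have h2 := mean_mem_Icc hm h0 hM h S
  rw [← hh, abs_le]
  constructor <;> linarith [h1.1, h1.2, h2.1, h2.2]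

theorem supDeviation_update_sub_le [IsProbabilityMeasure μ] [Finite ι] [Nonempty ι] (hm : 0 < m) (h0 : ∀ h z, 0 ≤ ℓ h z)
    (hM : ∀ h z, ℓ h z ≤ M) (S : Fin m → Z) (i : Fin m) (z : Z) :
    supDeviation μ ℓ (Function.update S i z) - supDeviation μ ℓ S ≤ M / m := by
  obtain ⟨h, hh⟩ := exists_eq_supDeviation μ ℓ (Function.update S i z)
  have h1 := le_supDeviation μ (ℓ := ℓ) S h
  have h2 : ∑ j, ℓ h (S j) - ∑ j, ℓ h (Function.update S i z j) ≤ M := by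
    rw [← Finset.sum_sub_distrib, Finset.sum_eq_single i]
    · linarith [hM h (S i), h0 h (Function.update S i z i)]
    · intro j _ hj
      rw [Function.update_of_ne hj, sub_self]
    · simp
  have h3 : (1 / (m : ℝ)) * (∑ j, ℓ h (S j) - ∑ j, ℓ h (Function.update S i z j)) ≤
      (1 / (m : ℝ)) * M := by gcongr
  rw [← hh]
  calc _ ≤ (1 / (m : ℝ)) * (∑ j, ℓ h (S j) - ∑ j, ℓ h (Function.update S i z j)) := by
        rw [mul_sub]; linarith
    _ ≤ _ := h3
    _ = M / m := by ring

theorem measurable_pairDeviation [Finite ι] (hℓ : ∀ h, Measurable (ℓ h)) :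
    Measurable (pairDeviation ℓ : (Fin m → Z × Z) → ℝ) := by
  refine Measurable.iSup fun h => ?_
  have := hℓ h
  fun_prop

/-- The ghost sample: for the maximizer `h` of the left side, the expectation over `S'` of the
paired difference is exactly `m` times its gap, and it lies below the integral of the supremum. -/
theorem supDeviation_le_integral_pairDeviation [IsProbabilityMeasure μ] [Finite ι] [Nonempty ι] (hm : 0 < m) (hℓ : ∀ h, Measurable (ℓ h))
    (h0 : ∀ h z, 0 ≤ ℓ h z) (hM : ∀ h z, ℓ h z ≤ M) (S : Fin m → Z) :
    m * supDeviation μ ℓ S ≤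
      ∫ S', pairDeviation ℓ (fun i => (S i, S' i)) ∂(Measure.pi fun _ : Fin m => μ) := by
  obtain ⟨h, hh⟩ := exists_eq_supDeviation μ ℓ S
  have hm' : (0 : ℝ) < m := by exact_mod_cast hm
  have hint : ∀ i, Integrable (fun S' : Fin m → Z => ℓ h (S' i))
      (Measure.pi fun _ : Fin m => μ) := fun i =>
    integrable_of_abs_le (by have := hℓ h; fun_prop) (C := M) fun S' => by
      rw [abs_of_nonneg (h0 h _)]; exact hM h _
  have hval : ∫ S' : Fin m → Z, ∑ i, (ℓ h (S' i) - ℓ h (S i)) ∂(Measure.pi fun _ : Fin m => μ) =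
      m * supDeviation μ ℓ S := by
    have hint' : ∀ i, Integrable (fun S' : Fin m → Z => ℓ h (S' i) - ℓ h (S i))
        (Measure.pi fun _ : Fin m => μ) := fun i => (hint i).sub (integrable_const _)
    rw [integral_finsetSum _ fun i _ => hint' i]
    have : ∀ i, ∫ S' : Fin m → Z, (ℓ h (S' i) - ℓ h (S i)) ∂(Measure.pi fun _ : Fin m => μ) =
        ∫ z, ℓ h z ∂μ - ℓ h (S i) := fun i => by
      rw [integral_sub (hint i) (integrable_const _)]
      have hev := measurePreserving_eval (fun _ : Fin m => μ) i
      have : ∫ S' : Fin m → Z, ℓ h (S' i) ∂(Measure.pi fun _ : Fin m => μ) = ∫ z, ℓ h z ∂μ := by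
        conv_rhs => rw [← hev.map_eq]
        rw [integral_map hev.measurable.aemeasurable (hℓ h).aestronglyMeasurable]
      rw [this]; simp
    rw [Finset.sum_congr rfl fun i _ => this i, Finset.sum_sub_distrib, ← hh]
    simp only [Finset.sum_const, Finset.card_univ, Fintype.card_fin, nsmul_eq_mul]
    field_simp
  rw [← hval]
  refine integral_mono (integrable_finsetSum _ fun i _ => (hint i).sub (integrable_const _))
    (integrable_of_abs_le ((measurable_pairDeviation hℓ).comp (by fun_prop)) fun S' =>
      abs_pairDeviation_le h0 hM _) fun S' => ?_
  exact le_ciSup (f := fun h => ∑ i, (ℓ h (S' i) - ℓ h (S i))) (Set.finite_range _).bddAbove h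

theorem measurePreserving_swapAt [IsProbabilityMeasure μ] (σ : Fin m → Bool) :
    MeasurePreserving (swapAt σ : (Fin m → Z × Z) → _) (Measure.pi fun _ : Fin m => μ.prod μ)
      (Measure.pi fun _ : Fin m => μ.prod μ) := by
  refine measurePreserving_pi (fun _ : Fin m => μ.prod μ) (fun _ => μ.prod μ)
    (f := fun i p => if σ i then p else p.swap) fun i => ?_
  by_cases h : σ i
  · simp only [h, if_true]; exact MeasurePreserving.id _
  · simp only [h]; exact Measure.measurePreserving_swap

/-- **Symmetrization**. -/
theorem integral_supDeviation_le [IsProbabilityMeasure μ] [Finite ι] [Nonempty ι] (hm : 0 < m) (hℓ : ∀ h, Measurable (ℓ h))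
    (h0 : ∀ h z, 0 ≤ ℓ h z) (hM : ∀ h z, ℓ h z ≤ M) {R : ℝ}
    (hR : ∀ (S : Fin m → Z) (w : (Fin m → Bool) → ι),
      𝔼 σ, ∑ i, boolSign (σ i) * ℓ (w σ) (S i) ≤ R) :
    m * ∫ S, supDeviation μ ℓ S ∂(Measure.pi fun _ : Fin m => μ) ≤ 2 * R := by
  have hmeas := measurable_pairDeviation (m := m) hℓ
  have hint : Integrable (pairDeviation ℓ) (Measure.pi fun _ : Fin m => μ.prod μ) :=
    integrable_of_abs_le hmeas fun S => abs_pairDeviation_le h0 hM S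
  have hmeas' : Measurable fun p : (Fin m → Z) × (Fin m → Z) =>
      pairDeviation ℓ (fun i => (p.1 i, p.2 i)) := hmeas.comp (by fun_prop)
  have hint' : Integrable (fun p : (Fin m → Z) × (Fin m → Z) =>
      pairDeviation ℓ (fun i => (p.1 i, p.2 i)))
      ((Measure.pi fun _ : Fin m => μ).prod (Measure.pi fun _ : Fin m => μ)) :=
    integrable_of_abs_le hmeas' fun p => abs_pairDeviation_le h0 hM _
  have hswap : ∀ σ : Fin m → Bool,
      ∫ S, pairDeviation ℓ (swapAt σ S) ∂(Measure.pi fun _ : Fin m => μ.prod μ) =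
        ∫ S, pairDeviation ℓ S ∂(Measure.pi fun _ : Fin m => μ.prod μ) := fun σ => by
    have h := measurePreserving_swapAt μ σ
    conv_rhs => rw [← h.map_eq]
    rw [integral_map h.measurable.aemeasurable hmeas.aestronglyMeasurable]
  calc m * ∫ S, supDeviation μ ℓ S ∂(Measure.pi fun _ : Fin m => μ)
      = ∫ S, m * supDeviation μ ℓ S ∂(Measure.pi fun _ : Fin m => μ) :=
        (integral_const_mul _ _).symm
    _ ≤ ∫ S, ∫ S', pairDeviation ℓ (fun i => (S i, S' i)) ∂(Measure.pi fun _ : Fin m => μ)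
          ∂(Measure.pi fun _ : Fin m => μ) := by
        refine integral_mono ((integrable_of_abs_le (measurable_supDeviation μ hℓ) fun S =>
          abs_supDeviation_le μ hm hℓ h0 hM S).const_mul _) hint'.integral_prod_left fun S => ?_
        exact supDeviation_le_integral_pairDeviation μ hm hℓ h0 hM S
    _ = ∫ p : (Fin m → Z) × (Fin m → Z), pairDeviation ℓ (fun i => (p.1 i, p.2 i))
          ∂((Measure.pi fun _ : Fin m => μ).prod (Measure.pi fun _ : Fin m => μ)) :=
        (integral_prod _ hint').symm
    _ = ∫ S, pairDeviation ℓ S ∂(Measure.pi fun _ : Fin m => μ.prod μ) := by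
        rw [← (measurePreserving_arrowProdEquivProdArrow Z Z (Fin m) (fun _ => μ)
          (fun _ => μ)).integral_comp']
        rfl
    _ = 𝔼 σ : Fin m → Bool,
          ∫ S, pairDeviation ℓ (swapAt σ S) ∂(Measure.pi fun _ : Fin m => μ.prod μ) := by
        simp_rw [hswap]; simp
    _ = ∫ S, 𝔼 σ, pairDeviation ℓ (swapAt σ S) ∂(Measure.pi fun _ : Fin m => μ.prod μ) := by
        simp_rw [Finset.expect_eq_sum_div_card]
        rw [integral_div, integral_finsetSum]
        exact fun σ _ => ((measurePreserving_swapAt μ σ).integrable_comp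
          hmeas.aestronglyMeasurable).2 hint
    _ ≤ ∫ _S, 2 * R ∂(Measure.pi fun _ : Fin m => μ.prod μ) := by
        refine integral_mono ?_ (integrable_const _) (expect_pairDeviation_swapAt_le hR)
        simp_rw [Finset.expect_eq_sum_div_card]
        exact (integrable_finsetSum _ fun σ _ => ((measurePreserving_swapAt μ σ).integrable_comp
          hmeas.aestronglyMeasurable).2 hint).div_const _
    _ = 2 * R := by simp

/-- A uniform deviation bound for a finite class whose Rademacher sums are bounded. -/
theorem measure_forall_le_of_rademacher [IsProbabilityMeasure μ] [Finite ι] [Nonempty ι] (hm : 0 < m) (hℓ : ∀ h, Measurable (ℓ h))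
    (h0 : ∀ h z, 0 ≤ ℓ h z) (hM : ∀ h z, ℓ h z ≤ M) {R : ℝ}
    (hR : ∀ (S : Fin m → Z) (w : (Fin m → Bool) → ι),
      𝔼 σ, ∑ i, boolSign (σ i) * ℓ (w σ) (S i) ≤ R) {δ : ℝ} (hδ0 : 0 < δ) (hδ1 : δ < 1) :
    ENNReal.ofReal (1 - δ) ≤ Measure.pi (fun _ : Fin m => μ)
      {S | ∀ h, ∫ z, ℓ h z ∂μ ≤ (1 / (m : ℝ)) * ∑ i, ℓ h (S i) + 2 * R / m +
        M * √(Real.log (1 / δ) / (2 * m))} := by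
  have hm' : (0 : ℝ) < m := by exact_mod_cast hm
  have hZ : Nonempty Z := μ.nonempty_of_neZero
  have hM0 : 0 ≤ M := (h0 (Classical.arbitrary ι) (Classical.arbitrary Z)).trans (hM _ _)
  set P := Measure.pi fun _ : Fin m => μ
  set f : (Fin m → Z) → ℝ := supDeviation μ ℓ
  set ε := M * √(Real.log (1 / δ) / (2 * m)) with hε
  have hε0 : 0 ≤ ε := by positivity
  have hlog : 0 < Real.log (1 / δ) := Real.log_pos (by rw [lt_div_iff₀ hδ0]; linarith)
  have hEf : ∫ S, f S ∂P ≤ 2 * R / m := by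
    rw [le_div_iff₀ hm', mul_comm]
    exact integral_supDeviation_le μ hm hℓ h0 hM hR
  have hfm : Measurable f := measurable_supDeviation μ hℓ
  have hbad : P.real {S | 2 * R / m + ε < f S} ≤ δ := by
    -- For `M = 0` the McDiarmid exponent degenerates to `0 / 0`, but then every deviation vanishes
    -- and the bad event is empty.
    rcases hM0.eq_or_lt with hM0 | hM0
    · have hf0 : ∀ S, f S = 0 := fun S => abs_eq_zero.1 (le_antisymm
        (by have := abs_supDeviation_le μ hm hℓ h0 hM S; rwa [← hM0] at this) (abs_nonneg _))
      have hR0 : 0 ≤ 2 * R / m := by simpa [hf0] using hEf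
      have : {S | 2 * R / m + ε < f S} = ∅ := by
        ext S; simp only [hf0, Set.mem_ofPred_eq, Set.mem_empty_iff_false, iff_false, not_lt]
        linarith
      rw [this]; simpa using hδ0.le
    · have hmc := mcdiarmid μ (c := M / m) hfm
        (abs_supDeviation_le μ hm hℓ h0 hM) (supDeviation_update_sub_le μ hm h0 hM) hε0
      have e : -(2 * ε ^ 2) / (m * (M / m) ^ 2) = Real.log δ := by
        rw [hε, mul_pow, Real.sq_sqrt (by positivity), one_div, Real.log_inv]
        field_simp
      rw [e, Real.exp_log hδ0] at hmc
      refine (measureReal_mono fun S hS => ?_).trans hmc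
      simp only [Set.mem_ofPred_eq] at hS ⊢
      linarith
  have hms : MeasurableSet {S | 2 * R / m + ε < f S} := measurableSet_lt measurable_const hfm
  have hgood : 1 - δ ≤ P.real {S | 2 * R / m + ε < f S}ᶜ := by
    rw [probReal_compl_eq_one_sub hms]; linarith
  refine (ENNReal.ofReal_le_ofReal hgood).trans ?_
  rw [ofReal_measureReal]
  refine measure_mono fun S hS h => ?_
  simp only [Set.mem_compl_iff, Set.mem_ofPred_eq, not_lt] at hS
  have := le_supDeviation μ (ℓ := ℓ) S h
  linarith

end Symmetrization

/-! ### Lipschitz continuity, bounds and measurability of the margin loss. -/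

section MarginLoss

variable {X Y : Type*}

theorem abs_clip_sub_clip_le (M r s : ℝ) : |clip M r - clip M s| ≤ |r - s| := by
  unfold clip
  refine (abs_min_sub_min_le_max M _ M _).trans ?_
  rw [sub_self, abs_zero, max_eq_right (abs_nonneg _)]
  refine (abs_max_sub_max_le_max 0 r 0 s).trans ?_
  rw [sub_self, abs_zero, max_eq_right (abs_nonneg _)]

theorem iSup_le_iSup_add {ι : Type*} [Finite ι] {f g : ι → ℝ} {ε : ℝ} (hε : 0 ≤ ε)
    (h : ∀ i, f i ≤ g i + ε) : ⨆ i, f i ≤ (⨆ i, g i) + ε := by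
  rcases isEmpty_or_nonempty ι with hι | hι
  -- Both suprema are `0` over an empty index, which is why `0 ≤ ε` is needed.
  · simpa [Real.iSup_of_isEmpty] using hε
  · exact ciSup_le fun i => (h i).trans
      (add_le_add_left (le_ciSup (Set.finite_range g).bddAbove i) ε)

/-- Clipping and maxima are 1-Lipschitz, and each margin `h x y - h x y'` involves two scores,
whence the factor `2 / ρ`. -/
theorem abs_marginLoss_sub_le [Finite Y] (L : Y → Y → ℝ) {ρ : ℝ} (hρ : 0 < ρ) (x : X) (y : Y)
    {h h' : X → Y → ℝ} {ε : ℝ} (hh : ∀ y', |h x y' - h' x y'| ≤ ε) :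
    |marginLoss L ρ x y h - marginLoss L ρ x y h'| ≤ 2 / ρ * ε := by
  have hε : 0 ≤ ε := (abs_nonneg _).trans (hh y)
  refine (abs_clip_sub_clip_le _ _ _).trans ?_
  have key : ∀ g g' : X → Y → ℝ, (∀ y', |g x y' - g' x y'| ≤ ε) → ∀ y' : {y' : Y // y' ≠ y},
      L y' y - (1 / ρ) * (g x y - g x y') ≤ L y' y - (1 / ρ) * (g' x y - g' x y') + 2 / ρ * ε := by
    intro g g' hg y'
    have h1 := abs_le.1 (hg y)
    have h2 := abs_le.1 (hg y')
    have h3 : (1 / ρ) * ((g' x y - g' x y') - (g x y - g x y')) ≤ (1 / ρ) * (2 * ε) := by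
      gcongr
      linarith [h1.1, h2.2]
    have h4 : (1 / ρ) * (2 * ε) = 2 / ρ * ε := by ring
    linarith
  have h1 := iSup_le_iSup_add (by positivity) (key h h' hh)
  have h2 := iSup_le_iSup_add (by positivity) (key h' h fun y' => by rw [abs_sub_comm]; exact hh y')
  rw [abs_le]
  constructor <;> linarith

theorem maxLoss_nonneg {L : Y → Y → ℝ} (hL : ∀ y y', 0 ≤ L y y') : 0 ≤ maxLoss L :=
  Real.iSup_nonneg fun z => hL z.1 z.2

theorem marginLoss_nonneg {L : Y → Y → ℝ} (hL : ∀ y y', 0 ≤ L y y') (ρ : ℝ) (x : X) (y : Y)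
    (h : X → Y → ℝ) : 0 ≤ marginLoss L ρ x y h :=
  le_min (maxLoss_nonneg hL) (le_max_left _ _)

theorem marginLoss_le (L : Y → Y → ℝ) (ρ : ℝ) (x : X) (y : Y)
    (h : X → Y → ℝ) : marginLoss L ρ x y h ≤ maxLoss L :=
  min_le_left _ _

theorem measurable_marginLoss [MeasurableSpace X] [MeasurableSpace Y] [MeasurableSingletonClass Y]
    [Finite Y] (L : Y → Y → ℝ) (ρ : ℝ) {h : X → Y → ℝ} (hh : ∀ y, Measurable fun x => h x y) :
    Measurable fun z : X × Y => marginLoss L ρ z.1 z.2 h := by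
  refine measurable_from_prod_countable_left fun y => ?_
  simp only [marginLoss, clip]
  refine measurable_const.min (measurable_const.max (Measurable.iSup fun y' => ?_))
  have h1 := hh y
  have h2 := hh y'
  fun_prop

end MarginLoss

/-! ### Linear scores as functionals on `ℓ_q`. -/

section LinearScores

variable {l D : ℕ} {F : Type*} [Fintype F] {X : Type*} {Y : Fin l → Type*} {G : FactorGraph l F}

/-- The functional `v ↦ ⟨w, v⟩` on `ℝ^D` with the `ℓ_q` norm. -/
noncomputable def pairing {D : ℕ} (q : ℝ) [Fact (1 ≤ ENNReal.ofReal q)] (w : Fin D → ℝ) :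
    StrongDual ℝ (PiLp (ENNReal.ofReal q) (fun _ : Fin D => ℝ)) :=
  LinearMap.toContinuousLinearMap
    { toFun := fun v => ∑ i, w i * v i
      map_add' := fun v v' => by simp [mul_add, Finset.sum_add_distrib]
      map_smul' := fun c v => by simp [Finset.mul_sum, mul_left_comm] }

theorem pairing_apply {q : ℝ} [Fact (1 ≤ ENNReal.ofReal q)] (w : Fin D → ℝ)
    (v : PiLp (ENNReal.ofReal q) (fun _ : Fin D => ℝ)) : pairing q w v = ∑ i, w i * v i := rfl

theorem ellNorm_ofLp {q : ℝ} (v : PiLp (ENNReal.ofReal q) (fun _ : Fin D => ℝ)) :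
    ellNorm q (WithLp.ofLp v) = ‖v‖ := rfl

theorem ellNorm_nonneg {p : ℝ} (hp : 0 < p) (v : Fin D → ℝ) : 0 ≤ ellNorm p v := by
  rw [ellNorm_eq_sum hp]
  positivity

theorem norm_pairing_le {p q : ℝ} [Fact (1 ≤ ENNReal.ofReal q)] (hpq : p.HolderConjugate q)
    (w : Fin D → ℝ) : ‖pairing q w‖ ≤ ellNorm p w := by
  refine ContinuousLinearMap.opNorm_le_bound _ (ellNorm_nonneg hpq.pos w) fun v => ?_
  rw [pairing_apply, ← ellNorm_ofLp v, ellNorm_eq_sum hpq.pos, ellNorm_eq_sum hpq.symm.pos,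
    Real.norm_eq_abs, abs_le]
  constructor
  · have := Real.inner_le_Lp_mul_Lq Finset.univ (fun i => -w i) (fun i => v i) hpq
    simp only [neg_mul, Finset.sum_neg_distrib, abs_neg] at this
    linarith
  · exact Real.inner_le_Lp_mul_Lq Finset.univ w (fun i => v i) hpq

/-- The scoring function of a functional on the feature space. -/
noncomputable def dualScore {q : ℝ} [Fact (1 ≤ ENNReal.ofReal q)]
    (Ψ : ∀ f : F, X → G.Label Y f → (Fin D → ℝ))
    (u : StrongDual ℝ (PiLp (ENNReal.ofReal q) (fun _ : Fin D => ℝ))) (x : X) (y : ∀ k, Y k) : ℝ :=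
  ∑ f, u (WithLp.toLp _ (Ψ f x (G.restrict f y)))

theorem dualScore_pairing {q : ℝ} [Fact (1 ≤ ENNReal.ofReal q)]
    (Ψ : ∀ f : F, X → G.Label Y f → (Fin D → ℝ)) (w : Fin D → ℝ) :
    dualScore Ψ (pairing q w) = linearScore Ψ w := by
  funext x y
  simp only [dualScore, linearScore, feature, pairing_apply, Finset.sum_apply, Finset.mul_sum]
  exact Finset.sum_comm

theorem abs_dualScore_sub_le {q : ℝ} [Fact (1 ≤ ENNReal.ofReal q)]
    (Ψ : ∀ f : F, X → G.Label Y f → (Fin D → ℝ))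
    {u u' : StrongDual ℝ (PiLp (ENNReal.ofReal q) (fun _ : Fin D => ℝ))} {x : X} {ε : ℝ}
    (h : ∀ (f : F) (y : G.Label Y f), |(u - u') (WithLp.toLp _ (Ψ f x y))| ≤ ε) (y : ∀ k, Y k) :
    |dualScore Ψ u x y - dualScore Ψ u' x y| ≤ Fintype.card F * ε := by
  rw [dualScore, dualScore, ← Finset.sum_sub_distrib]
  refine (Finset.abs_sum_le_sum_abs _ _).trans ?_
  calc _ ≤ ∑ _f : F, ε := Finset.sum_le_sum fun f _ => by simpa using h f (G.restrict f y)
    _ = _ := by simp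

theorem continuous_linearScore (Ψ : ∀ f : F, X → G.Label Y f → (Fin D → ℝ)) (x : X)
    (y : ∀ k, Y k) : Continuous fun w => linearScore Ψ w x y := by
  unfold linearScore
  fun_prop

theorem measurable_linearScore [MeasurableSpace X] {Ψ : ∀ f : F, X → G.Label Y f → (Fin D → ℝ)}
    (hΨ : ∀ (f : F) (y : G.Label Y f), Measurable (fun x => Ψ f x y)) (w : Fin D → ℝ)
    (y : ∀ k, Y k) : Measurable fun x => linearScore Ψ w x y := by
  simp only [linearScore, feature, Finset.sum_apply]
  refine Finset.measurable_sum _ fun i _ => measurable_const.mul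
    (Finset.measurable_sum _ fun f _ => (measurable_pi_apply i).comp (hΨ f _))

theorem continuous_marginLoss_linearScore [∀ k, Finite (Y k)]
    (Ψ : ∀ f : F, X → G.Label Y f → (Fin D → ℝ)) (L : (∀ k, Y k) → (∀ k, Y k) → ℝ) {ρ : ℝ}
    (hρ : 0 < ρ) (x : X) (y : ∀ k, Y k) :
    Continuous fun w => marginLoss L ρ x y (linearScore Ψ w) := by
  have := Fintype.ofFinite (∀ k, Y k)
  refine continuous_iff_continuousAt.2 fun w₀ => tendsto_iff_dist_tendsto_zero.2 ?_
  have hlim : Filter.Tendsto (fun w => 2 / ρ * ∑ y', |linearScore Ψ w x y' - linearScore Ψ w₀ x y'|)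
      (nhds w₀) (nhds 0) := by
    have hc : Continuous fun w =>
        2 / ρ * ∑ y', |linearScore Ψ w x y' - linearScore Ψ w₀ x y'| := by
      have := continuous_linearScore Ψ x
      fun_prop
    simpa using hc.tendsto w₀
  refine squeeze_zero (fun _ => dist_nonneg) (fun w => ?_) hlim
  rw [Real.dist_eq]
  exact abs_marginLoss_sub_le L hρ x y fun y' => Finset.single_le_sum
    (f := fun y' => |linearScore Ψ w x y' - linearScore Ψ w₀ x y'|)
    (fun _ _ => abs_nonneg _) (Finset.mem_univ y')

end LinearScores

/-! ### Covering the class on the sample and bounding its Rademacher sums. -/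

section RademacherBound

open Finset BigOperators

variable {l D : ℕ} {F : Type*} [Fintype F] {X : Type*} {Y : Fin l → Type*} [∀ k, Finite (Y k)]
  {G : FactorGraph l F}

/-- This is `exists_finset_approx` with `k = 4 ^ j`, in the form used by `chaining`. At `j = 0` the
zero functional alone suffices, giving the required one-point start. -/
theorem exists_finset_dual_approx {q : ℝ} (hq : 2 ≤ q) [Fact (1 ≤ ENNReal.ofReal q)] {ι : Type*}
    [Fintype ι] {v : ι → PiLp (ENNReal.ofReal q) (fun _ : Fin D => ℝ)} {B Λ : ℝ} (hB : 0 ≤ B)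
    (hΛ : 0 ≤ Λ) (hv : ∀ i, ‖v i‖ ≤ B) (j : ℕ) :
    ∃ T : Finset (StrongDual ℝ (PiLp (ENNReal.ofReal q) (fun _ : Fin D => ℝ))),
      (T.card : ℝ) ≤ Real.exp (4 ^ j * Real.log (2 * Fintype.card ι + 1)) ∧
      (j = 0 → T.card ≤ 1) ∧
      ∀ u : StrongDual ℝ (PiLp (ENNReal.ofReal q) (fun _ : Fin D => ℝ)), ‖u‖ ≤ Λ →
        ∃ u' ∈ T, ∀ i, |(u - u') (v i)| ≤ 2 * √(4 * q) * Λ * B / 2 ^ j := by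
  rcases Nat.eq_zero_or_pos j with rfl | hj
  · refine ⟨{0}, ?_, by simp, fun u hu => ⟨0, by simp, fun i => ?_⟩⟩
    · rw [card_singleton, Nat.cast_one, Real.one_le_exp_iff]
      have : 0 ≤ Real.log (2 * Fintype.card ι + 1) :=
        Real.log_nonneg (by linarith [Nat.cast_nonneg (α := ℝ) (Fintype.card ι)])
      positivity
    · have h1 : 1 ≤ √(4 * q) := Real.one_le_sqrt.2 (by linarith)
      have h2 : 0 ≤ Λ * B := mul_nonneg hΛ hB
      calc |(u - 0) (v i)| ≤ ‖u‖ * ‖v i‖ := by simpa using u.le_opNorm (v i)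
        _ ≤ Λ * B := by gcongr; exact hv i
        _ ≤ 2 * √(4 * q) * Λ * B / 2 ^ 0 := by
          rw [pow_zero, div_one, mul_assoc]
          nlinarith
  · obtain ⟨T, hT, hcov⟩ := exists_finset_approx (K := 4 * q) (by linarith)
      (fun x y => sq_norm_add_sq_norm_sub_le hq (WithLp.ofLp x) (WithLp.ofLp y)) hB hv hΛ
      (k := 4 ^ j) (by positivity)
    refine ⟨T, ?_, fun h => absurd h hj.ne', fun u hu => ?_⟩
    · have hpos : (0 : ℝ) < 2 * Fintype.card ι + 1 := by positivity
      have h4 : ((4 : ℝ) ^ j) = ((4 ^ j : ℕ) : ℝ) := by push_cast; rfl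
      rw [h4, ← Real.log_pow, Real.exp_log (by positivity)]
      exact_mod_cast hT
    · have h4 : √((4 ^ j : ℕ) : ℝ) = 2 ^ j := by
        push_cast
        rw [show (4 : ℝ) ^ j = (2 ^ j) ^ 2 by rw [← pow_mul, mul_comm j 2, pow_mul]; norm_num]
        exact Real.sqrt_sq (by positivity)
      rw [h4] at hcov
      exact hcov u hu

theorem card_points {d : ℕ} (hd : ∀ f, Nat.card (G.Label Y f) = d) (m : ℕ) :
    Nat.card (Fin m × (Σ f, G.Label Y f)) = m * d * Fintype.card F := by
  rw [Nat.card_prod, Nat.card_sigma, Finset.sum_congr rfl fun f _ => hd f]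
  simp
  ring

/-- The Rademacher sums of the margin loss of linear scores. -/
theorem rademacher_marginLoss_le {m d : ℕ} (hd : ∀ f, Nat.card (G.Label Y f) = d)
    (L : (∀ k, Y k) → (∀ k, Y k) → ℝ) (Ψ : ∀ f : F, X → G.Label Y f → (Fin D → ℝ)) {p q : ℝ}
    (hpq : p.HolderConjugate q) (hq : 2 ≤ q) {B Λ ρ : ℝ} (hB : 0 ≤ B) (hΛ : 0 ≤ Λ) (hρ : 0 < ρ)
    (hΨB : ∀ f x y, ellNorm q (Ψ f x y) ≤ B) (J : ℕ) (S : Fin m → X × (∀ k, Y k))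
    (w : (Fin m → Bool) → Fin D → ℝ) (hw : ∀ σ, ellNorm p (w σ) ≤ Λ) :
    𝔼 σ, ∑ i, boolSign (σ i) * marginLoss L ρ (S i).1 (S i).2 (linearScore Ψ (w σ)) ≤
      m * (4 * √(4 * q) * Λ * B * Fintype.card F / ρ / 2 ^ J) +
        J * (3 / 2 * √m * (4 * √(4 * q) * Λ * B * Fintype.card F / ρ) *
          √(10 * Real.log (2 * (m * d * Fintype.card F) + 1))) := by
  have : Fact (1 ≤ ENNReal.ofReal q) := ⟨by rw [ENNReal.one_le_ofReal]; linarith⟩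
  have := Fintype.ofFinite (Fin m × (Σ f, G.Label Y f))
  -- The points to be approximated are indexed by a sample, a factor and a partial label; there are
  -- `m d |F|` of them.
  have hv : ∀ j : Fin m × (Σ f, G.Label Y f),
      ‖(WithLp.toLp (ENNReal.ofReal q) (Ψ j.2.1 (S j.1).1 j.2.2) :
        PiLp (ENNReal.ofReal q) (fun _ : Fin D => ℝ))‖ ≤ B := fun j => hΨB _ _ _
  choose T hT hT0 hcov using exists_finset_dual_approx hq hB hΛ hv
  have hcard : (Fintype.card (Fin m × (Σ f, G.Label Y f)) : ℝ) = m * d * Fintype.card F := by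
    rw [← Nat.card_eq_fintype_card, card_points hd]; push_cast; rfl
  rw [hcard] at hT
  have h := chaining (fun u i => marginLoss L ρ (S i).1 (S i).2 (dualScore Ψ u))
    {u : StrongDual ℝ (PiLp (ENNReal.ofReal q) (fun _ : Fin D => ℝ)) | ‖u‖ ≤ Λ} T
    -- The base scale is the functional accuracy `2 √(4q) Λ B`, multiplied by `|F|` for the sum over
    -- factors and by the Lipschitz constant `2 / ρ`.
    (e := 4 * √(4 * q) * Λ * B * Fintype.card F / ρ) (by positivity)
    (Real.log_nonneg (by
      have : (0 : ℝ) ≤ m * d * Fintype.card F := by positivity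
      linarith)) hT (hT0 0 rfl)
    (fun j u hu => by
      obtain ⟨u', hu', hε⟩ := hcov j u hu
      refine ⟨u', hu', fun i => (abs_marginLoss_sub_le L hρ _ _ fun y' =>
        abs_dualScore_sub_le Ψ (fun f y => hε ⟨i, f, y⟩) y').trans (le_of_eq ?_)⟩
      ring)
    J (fun σ => pairing q (w σ)) (fun σ => (norm_pairing_le hpq _).trans (hw σ))
  simpa only [dualScore_pairing] using h

end RademacherBound

/-! ### Numerical constants and the passage from finite families to the whole ball. -/

section GeneralizationBound

/-- Taking `Nat.log 2 m` levels makes the finest scale of order `e / m`. The residual term costs at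
most `24` and the levels at most `80`; doubling for symmetrization gives `208 ≤ 288`. -/
theorem chaining_constants_le {m d N : ℕ} {q B Λ ρ : ℝ} (hm : 2 ≤ m) (hd : 0 < N → 0 < d)
    (hq : 2 ≤ q) (hB : 0 ≤ B) (hΛ : 0 ≤ Λ) (hρ : 0 < ρ) :
    2 * (m * (4 * √(4 * q) * Λ * B * N / ρ / 2 ^ Nat.log 2 m) +
        Nat.log 2 m * (3 / 2 * √m * (4 * √(4 * q) * Λ * B * N / ρ) *
          √(10 * Real.log (2 * (m * d * N) + 1)))) / m ≤
      288 * √(q - 1) * B * Λ * N / (ρ * √m) * logFactor m d N B Λ ρ := by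
  rcases Nat.eq_zero_or_pos N with rfl | hN
  · simp
  have hd := hd hN
  have hmR : (2 : ℝ) ≤ m := by exact_mod_cast hm
  have hdR : (1 : ℝ) ≤ d := by exact_mod_cast hd
  have hNR : (1 : ℝ) ≤ N := by exact_mod_cast hN
  set s := √(m : ℝ) with hs
  have hs2 : s ^ 2 = m := Real.sq_sqrt (by positivity)
  have hs0 : 0 < s := by positivity
  have hs1 : 1.41 ≤ s := by rw [hs]; exact Real.le_sqrt_of_sq_le (by norm_num; linarith)
  set Q := √(q - 1) with hQ
  -- Since `q ≥ 2`, one has `4 q ≤ 8 (q - 1)`, and `2.83² > 8`.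
  have hKQ : √(4 * q) ≤ 2.83 * Q := by
    rw [hQ]
    refine Real.sqrt_le_iff.2 ⟨by positivity, ?_⟩
    rw [mul_pow, Real.sq_sqrt (by linarith)]
    nlinarith
  set P := m * d * N * (1 : ℝ) with hP
  have hP2 : 2 ≤ P := by
    have : (1 : ℝ) ≤ d * N := one_le_mul_of_one_le_of_one_le hdR hNR
    rw [hP]; nlinarith
  have hBr : 0 ≤ 8 * B * Λ * m * N / ρ := by positivity
  set W := √(Real.log (2 * m * d * N * (8 * B * Λ * m * N / ρ + 3) + 1)) with hW
  -- The covering cardinality involves only `2 m d N + 1`; the bracket enters only through being at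
  -- least `1`.
  have hlogle : Real.log (2 * (m * d * N) + 1) ≤
      Real.log (2 * m * d * N * (8 * B * Λ * m * N / ρ + 3) + 1) := by
    refine Real.log_le_log (by positivity) ?_
    have : 0 ≤ (m : ℝ) * d * N := by positivity
    nlinarith [mul_nonneg this hBr]
  have hW1 : 1 ≤ W := by
    refine Real.one_le_sqrt.2 (le_trans ?_ hlogle)
    rw [Real.le_log_iff_exp_le (by positivity)]
    have := Real.exp_one_lt_d9
    linarith
  have hroot : √(10 * Real.log (2 * (m * d * N) + 1)) ≤ 3.17 * W := by
    rw [Real.sqrt_mul (by norm_num)]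
    have h1 : √10 ≤ 3.17 := Real.sqrt_le_iff.2 ⟨by norm_num, by norm_num⟩
    have h2 : √(Real.log (2 * (m * d * N) + 1)) ≤ W := Real.sqrt_le_sqrt hlogle
    gcongr
  set g := Real.log m with hg
  have hg0 : 0.69 ≤ g := by
    have h1 := Real.log_two_gt_d9
    have h2 : Real.log 2 ≤ g := Real.log_le_log (by norm_num) hmR
    linarith
  set J := Nat.log 2 m with hJ
  have hJg : (J : ℝ) * 0.69 ≤ g := by
    have h1 : ((2 ^ J : ℕ) : ℝ) ≤ m := by exact_mod_cast Nat.pow_log_le_self 2 (by omega)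
    have h2 := Real.log_le_log (by positivity) h1
    push_cast at h2
    rw [Real.log_pow] at h2
    have h3 := Real.log_two_gt_d9
    have h4 : (J : ℝ) * 0.69 ≤ J * Real.log 2 := by gcongr; linarith
    linarith
  have hJm : s ^ 2 ≤ 2 * 2 ^ J := by
    have h1 : m < 2 ^ (J + 1) := Nat.lt_pow_succ_log_self (by norm_num) m
    have h2 : (m : ℝ) < 2 ^ (J + 1) := by exact_mod_cast h1
    rw [hs2]; rw [pow_succ] at h2; linarith
  set A := Λ * B * N / ρ with hA
  have hA0 : 0 ≤ A := by positivity
  have hQ0 : 0 ≤ Q := Real.sqrt_nonneg _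
  have hlf : logFactor m d N B Λ ρ = W * g := rfl
  set e := 4 * √(4 * q) * Λ * B * N / ρ with he
  have heA : e ≤ 11.32 * (Q * A) := by
    have : e = 4 * √(4 * q) * A := by rw [he, hA]; ring
    rw [this]
    calc 4 * √(4 * q) * A ≤ 4 * (2.83 * Q) * A := by gcongr
      _ = _ := by ring
  have he0 : 0 ≤ e := by positivity
  have hWg : 0.69 ≤ W * g := by nlinarith
  clear_value s Q P W g J A e
  have hfirst : e / 2 ^ J ≤ 24 * (Q * A) * (W * g) / s := by
    rw [div_le_div_iff₀ (by positivity) hs0]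
    have h1 : 1.41 * s ≤ 2 * 2 ^ J := by nlinarith
    have hQA : 0 ≤ Q * A := by positivity
    calc e * s ≤ 11.32 * (Q * A) * s := by gcongr
      _ ≤ 11.32 * (Q * A) * (2 / 1.41 * 2 ^ J) := by gcongr; linarith
      _ ≤ 24 * (Q * A) * 0.69 * 2 ^ J := by
        have : 0 ≤ Q * A * 2 ^ J := by positivity
        nlinarith
      _ ≤ 24 * (Q * A) * (W * g) * 2 ^ J := by gcongr
  have hsecond : (J : ℝ) * (3 / 2 * e * √(10 * Real.log (2 * (m * d * N) + 1))) / s ≤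
      80 * (Q * A) * (W * g) / s := by
    refine div_le_div_of_nonneg_right ?_ hs0.le
    have hJ' : (J : ℝ) ≤ g / 0.69 := by rw [le_div_iff₀ (by norm_num)]; exact hJg
    calc (J : ℝ) * (3 / 2 * e * √(10 * Real.log (2 * (m * d * N) + 1)))
        ≤ g / 0.69 * (3 / 2 * (11.32 * (Q * A)) * (3.17 * W)) := by gcongr
      _ = (3 / 2 * 11.32 * 3.17 / 0.69) * ((Q * A) * (W * g)) := by ring
      _ ≤ 80 * ((Q * A) * (W * g)) := by
        have : 0 ≤ (Q * A) * (W * g) := by positivity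
        gcongr
        norm_num
      _ = _ := by ring
  calc 2 * (m * (e / 2 ^ J) + J * (3 / 2 * s * e * √(10 * Real.log (2 * (m * d * N) + 1)))) / m
      = 2 * (e / 2 ^ J +
          J * (3 / 2 * e * √(10 * Real.log (2 * (m * d * N) + 1))) / s) := by
        rw [← hs2]; field_simp
    _ ≤ 2 * (24 * (Q * A) * (W * g) / s + 80 * (Q * A) * (W * g) / s) := by gcongr
    _ = 208 * ((Q * A) * (W * g) / s) := by ring
    _ ≤ 288 * ((Q * A) * (W * g) / s) := by
        have : 0 ≤ (Q * A) * (W * g) / s := by positivity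
        gcongr
        norm_num
    _ = _ := by
        rw [hlf, hA]; field_simp

variable {l D m d : ℕ} {F X : Type*} [Fintype F] {Y : Fin l → Type*} [∀ k, Finite (Y k)]
  {G : FactorGraph l F}

theorem continuous_risk_linearScore [MeasurableSpace X] [∀ k, MeasurableSpace (Y k)]
    [∀ k, MeasurableSingletonClass (Y k)] {L : (∀ k, Y k) → (∀ k, Y k) → ℝ} (hL : ∀ y y', 0 ≤ L y y')
    (𝒟 : Measure (X × (∀ k, Y k))) [IsProbabilityMeasure 𝒟]
    {Ψ : ∀ f : F, X → G.Label Y f → (Fin D → ℝ)}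
    (hΨ : ∀ (f : F) (y : G.Label Y f), Measurable (fun x => Ψ f x y)) {ρ : ℝ} (hρ : 0 < ρ) :
    Continuous fun w => risk 𝒟 L ρ (linearScore Ψ w) := by
  refine continuous_of_dominated (bound := fun _ => maxLoss L)
    (fun w => (measurable_marginLoss L ρ (measurable_linearScore hΨ w)).aestronglyMeasurable)
    (fun w => Filter.Eventually.of_forall fun z => ?_) (integrable_const _)
    (Filter.Eventually.of_forall fun z => continuous_marginLoss_linearScore Ψ L hρ z.1 z.2)
  rw [Real.norm_of_nonneg (marginLoss_nonneg hL _ _ _ _)]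
  exact marginLoss_le _ _ _ _ _

theorem continuous_empRisk_linearScore (L : (∀ k, Y k) → (∀ k, Y k) → ℝ)
    (Ψ : ∀ f : F, X → G.Label Y f → (Fin D → ℝ)) {ρ : ℝ} (hρ : 0 < ρ)
    (S : Fin m → X × (∀ k, Y k)) : Continuous fun w => empRisk S L ρ (linearScore Ψ w) :=
  continuous_const.mul (continuous_finsetSum _ fun i _ =>
    continuous_marginLoss_linearScore Ψ L hρ (S i).1 (S i).2)

/-- A bound holding with high probability for all finite families of parameters in a set holds
with the same probability for the whole set. -/
theorem measure_forall_mem_of_forall_finite {Ω W : Type*} [MeasurableSpace Ω] (P : Measure Ω)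
    [IsProbabilityMeasure P] [TopologicalSpace W] [SecondCountableTopology W] {s : Set W}
    (hs : s.Nonempty) {a : W → ℝ} (ha : Continuous a) {b : Ω → W → ℝ}
    (hb : ∀ S, Continuous (b S)) (hbm : ∀ w, Measurable fun S => b S w) {r : ENNReal}
    (hfin : ∀ (n : ℕ) (w : Fin (n + 1) → W), (∀ i, w i ∈ s) →
      r ≤ P {S | ∀ i, a (w i) ≤ b S (w i)}) :
    r ≤ P {S | ∀ w ∈ s, a w ≤ b S w} := by
  have := hs.to_subtype
  let u : ℕ → s := TopologicalSpace.denseSeq s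
  let A : ℕ → Set Ω := fun n => {S | ∀ i : Fin (n + 1), a (u i) ≤ b S (u i)}
  have hAm : ∀ n, MeasurableSet (A n) := fun n => by
    have : A n = ⋂ i : Fin (n + 1), {S | a (u i) ≤ b S (u i)} := by
      ext S; simp [A]
    rw [this]
    exact MeasurableSet.iInter fun i => measurableSet_le measurable_const (hbm _)
  have hanti : Antitone A := fun n n' hn S hS i => hS (Fin.castLE (by omega) i)
  have hlim := tendsto_measure_iInter_atTop (μ := P) (fun n => (hAm n).nullMeasurableSet) hanti
    ⟨0, measure_ne_top _ _⟩
  have hr : r ≤ P (⋂ n, A n) := ge_of_tendsto' hlim fun n => hfin n _ fun i => (u i).2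
  refine hr.trans (measure_mono fun S hS => ?_)
  -- For a fixed sample the inequality is a closed condition on `w`, so it passes from the dense
  -- sequence to all of `s`.
  have hclosed : IsClosed {w : s | a w ≤ b S w} :=
    isClosed_le (ha.comp continuous_subtype_val) ((hb S).comp continuous_subtype_val)
  have hsub : Set.range u ⊆ {w : s | a w ≤ b S w} := by
    rintro _ ⟨n, rfl⟩
    exact Set.mem_iInter.1 hS n (Fin.last n)
  have huniv := hclosed.closure_subset_iff.2 hsub
  rw [(TopologicalSpace.denseRange_denseSeq s).closure_range] at huniv
  exact fun w hw => huniv (Set.mem_univ (⟨w, hw⟩ : s))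

end GeneralizationBound

end StructuredPrediction

theorem mainTheorem2 {l D m d : ℕ} {F X : Type*} [Fintype F] [MeasurableSpace X]
    {Y : Fin l → Type*} [∀ k, Finite (Y k)] [∀ k, MeasurableSpace (Y k)]
    [∀ k, MeasurableSingletonClass (Y k)]
    (G : StructuredPrediction.FactorGraph l F)
    (hd : ∀ f, Nat.card (G.Label Y f) = d)
    (L : (∀ k, Y k) → (∀ k, Y k) → ℝ) (hL : ∀ y y', 0 ≤ L y y')
    (𝒟 : Measure (X × (∀ k, Y k))) [IsProbabilityMeasure 𝒟]
    (Ψ : ∀ f : F, X → G.Label Y f → (Fin D → ℝ))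
    (hΨ : ∀ (f : F) (y : G.Label Y f), Measurable (fun x => Ψ f x y))
    (p q : ℝ) (hp1 : 1 < p) (hp2 : p ≤ 2) (hq : q = p / (p - 1))
    (hΨb : BddAbove (StructuredPrediction.featureNorms Ψ q))
    (Λ : ℝ) (hΛ : 0 ≤ Λ) (hm : 2 ≤ m)
    (ρ : ℝ) (hρ : 0 < ρ) (δ : ℝ) (hδ0 : 0 < δ) (hδ1 : δ < 1) :
    ENNReal.ofReal (1 - δ) ≤ Measure.pi (fun _ : Fin m => 𝒟)
      {S : Fin m → X × (∀ k, Y k) |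
        ∀ h ∈ StructuredPrediction.hypothesisClass Ψ p Λ,
          StructuredPrediction.risk 𝒟 L ρ h ≤
            StructuredPrediction.empRisk S L ρ h + 8 / m
              + 288 * √(q - 1) * StructuredPrediction.featureSup Ψ q * Λ * Fintype.card F
                  / (ρ * √m)
                * StructuredPrediction.logFactor m d (Fintype.card F)
                    (StructuredPrediction.featureSup Ψ q) Λ ρ
              + StructuredPrediction.maxLoss L * √(Real.log (1 / δ) / (2 * m))} := by
  open StructuredPrediction in
  have hpq : p.HolderConjugate q := by
    rw [hq]; exact (Real.holderConjugate_iff_eq_conjExponent hp1).2 rfl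
  have hq2 : 2 ≤ q := by
    rw [hq, le_div_iff₀ (by linarith)]; linarith
  obtain ⟨z₀⟩ : Nonempty (X × (∀ k, Y k)) := 𝒟.nonempty_of_neZero
  set B := featureSup Ψ q with hBdef
  have hΨB : ∀ f x y, ellNorm q (Ψ f x y) ≤ B := fun f x y => le_csSup hΨb ⟨f, x, y, rfl⟩
  have hB : 0 ≤ B := Real.sSup_nonneg fun r ⟨f, x, y, h⟩ => by
    rw [h]; exact ellNorm_nonneg (by linarith) _
  -- A probability space is nonempty, so some full label exists and its restriction inhabits each
  -- `𝒴_f`.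
  have hd0 : 0 < Fintype.card F → 0 < d := fun h => by
    obtain ⟨f⟩ := Fintype.card_pos_iff.1 h
    rw [← hd f]
    have : Nonempty (G.Label Y f) := ⟨G.restrict f z₀.2⟩
    exact Nat.card_pos
  set c := 288 * √(q - 1) * B * Λ * Fintype.card F / (ρ * √m) *
    logFactor m d (Fintype.card F) B Λ ρ with hc
  set t := maxLoss L * √(Real.log (1 / δ) / (2 * m)) with ht
  have hconst := chaining_constants_le (ρ := ρ) hm hd0 hq2 hB hΛ hρ
  have hcont : ∀ S : Fin m → X × (∀ k, Y k), Continuous fun w =>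
      empRisk S L ρ (linearScore Ψ w) + 8 / m + c + t := fun S => by
    have := continuous_empRisk_linearScore L Ψ hρ S
    fun_prop
  have hmeas : ∀ w, Measurable fun S : Fin m → X × (∀ k, Y k) =>
      empRisk S L ρ (linearScore Ψ w) + 8 / m + c + t := fun w => by
    have h := measurable_marginLoss L ρ (measurable_linearScore hΨ w)
    have : Measurable fun S : Fin m → X × (∀ k, Y k) => empRisk S L ρ (linearScore Ψ w) :=
      measurable_const.mul (Finset.measurable_sum _ fun i _ => h.comp (measurable_pi_apply i))
    fun_prop
  refine (measure_forall_mem_of_forall_finite (Measure.pi fun _ : Fin m => 𝒟)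
    (s := {w : Fin D → ℝ | ellNorm p w ≤ Λ}) ⟨0, ?_⟩
    (continuous_risk_linearScore hL 𝒟 hΨ hρ) hcont hmeas fun n w hw => ?_).trans
    (measure_mono ?_)
  · have hp0 : p ≠ 0 := by linarith
    rw [Set.mem_ofPred_eq, ellNorm_eq_sum (by linarith)]
    simpa [Real.zero_rpow hp0, Real.zero_rpow (inv_ne_zero hp0)] using hΛ
  · have hR := fun (S : Fin m → X × (∀ k, Y k)) (v : (Fin m → Bool) → Fin (n + 1)) =>
      rademacher_marginLoss_le hd L Ψ hpq hq2 hB hΛ hρ hΨB (Nat.log 2 m) S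
        (fun σ => w (v σ)) fun σ => hw (v σ)
    have hfinite := measure_forall_le_of_rademacher 𝒟 (m := m) (by omega)
      (ℓ := fun (i : Fin (n + 1)) z => marginLoss L ρ z.1 z.2 (linearScore Ψ (w i)))
      (fun i => measurable_marginLoss L ρ (measurable_linearScore hΨ (w i)))
      (fun i z => marginLoss_nonneg hL ρ _ _ _) (fun i z => marginLoss_le L ρ _ _ _)
      (fun S v => by exact hR S v) hδ0 hδ1
    refine hfinite.trans (measure_mono fun S hS i => ?_)
    refine (hS i).trans ?_
    -- The chaining estimate already fits into the main term, so `8 / m` is pure slack.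
    have h8 : (0 : ℝ) ≤ 8 / m := by positivity
    simp only [empRisk]
    linarith
  · rintro S hS h ⟨w, hw, rfl⟩
    exact hS w hw
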